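/- Let $K$ be a non-archimedean local field with ring of integers $\mathcal{O}_K$, maximal ideal $\mathfrak{p}_K$ and finite residue field of characteristic $p$, and let $f, g \in \mathcal{O}_K[T]$ be monic Eisenstein polynomials of the same degree $n$. Let $\pi$ be a root of $f$, put $L = K(\pi)$, assume that $L/K$ is separable, and suppose that $g$ has a root $\rho \in L$. Let $v_L$ be the valuation of $L$, extended to a separable closure $L^{\mathrm{sep}}$, normalized by $v_L(\pi) = 1$, with $v_L(0)=+\infty$. Assume that $\pi = \rho + \theta\rho^{m+1} + O(\rho^{m+2})$ for some $\theta \in \mathcal{O}_K$ and some integer $m \ge 0$, that is, $v_L(\pi - \rho - \theta\rho^{m+1}) \ge m+2$. Notation. For a $K$-embedding $\sigma : L \to L^{\mathrm{sep}}$ put $i(\sigma) = \min_{0 \ne x \in \mathcal{O}_L} v_L(\sigma(x)/x - 1)$, let $\Gamma_t = \{\sigma : i(\sigma) \ge t\}$, and $\phi(x) = \frac1n \int_0^x \#\Gamma_t\, dt$ for $x \ge 0$. Let $p^s$ be the largest power of $p$ dividing $n$. For $0 \le j \le s$ let $\tau_j$ be the smallest real $t \ge 0$ such that $n\phi$ has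 slope $\le p^j$ on $[t, \infty)$, and put $\xi_j = n\phi(\tau_j) - p^j\tau_j$. For real $w$ let $P_{p^j}(w)$ be the $\mathcal{O}_K$-module generated by the monomials $cT^i$ with $c \in \mathcal{O}_K$, $p^j \mid i$ and $v_L(c) + i \ge w$. The Newton polygon of $h = \sum_k h_k T^k \in L[T]$ is the convex hull in $\mathbb{R}^2$ of the union, over the $k$ with $h_k \ne 0$, of the quadrants $(k, v_L(h_k)) + \mathbb{R}_{\ge 0}^2$. Then $$f(T) \equiv g(T) \mod \sum_{j=0}^{s} P_{p^j}(\xi_j + n + p^j m),$$ and the Newton polygon of $f(\pi + \pi T) - f(\pi) - g(\pi + \pi T) + g(\pi)$ is contained in the Newton polygon of $f(\pi + \pi^{m+1}T)$. -/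

import Mathlib

open ValuativeRel Polynomial

noncomputable section

namespace RamEisenstein

variable (K : Type*) [Field K] [ValuativeRel K] [TopologicalSpace K] [IsNonarchimedeanLocalField K]

/-- The normalized valuation `v_K : Kˣ → ℤ` of a local field, viewed with values in `ℝ`
(the value at `0` is irrelevant, it is never used). -/
def vBase (x : K) : ℝ :=
  ((-WithZero.log (IsNonarchimedeanLocalField.valueGroupWithZeroIsoInt K (valuation K x)) : ℤ) : ℝ)

variable (L : Type*) [Field L] [Algebra K L]

/-- The valuation `v_L`, for `L / K` finite and totally ramified, on every algebraic extension `M`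
of `K`: it is the unique valuation of `M` that restricts to `[L : K] • v_K` on `K`, that is
`v_L(y) = [L : K] * v_K(N(y)) / [K(y) : K]`, where `N(y)` is the norm from `K(y)` to `K`, which
is up to sign the constant term of the minimal polynomial of `y`. Moreover `v_L(0) = +∞`. -/
def vExt {M : Type*} [Field M] [Algebra K M] (y : M) : EReal :=
  open scoped Classical in
  if y = 0 then ⊤
  else (((Module.finrank K L : ℝ) * vBase K ((minpoly K y).coeff 0) /
    ((minpoly K y).natDegree : ℝ) : ℝ) : EReal)

/-- `i_{L/K}(σ) = min_x v_L(σ(x) / x - 1)`, over the nonzero elements `x` of the ring of integers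
of `L`, for a `K`-embedding `σ` of `L` into its separable closure. -/
def ramIndex (σ : L →ₐ[K] SeparableClosure L) : EReal :=
  ⨅ x : {x : L // x ≠ 0 ∧ 0 ≤ vExt K L x},
    vExt K L (σ x.1 / algebraMap L (SeparableClosure L) x.1 - 1)

/-- The ramification subset `Γ_t` of the set of `K`-embeddings of `L`. -/
def ramSet (t : ℝ) : Set (L →ₐ[K] SeparableClosure L) :=
  {σ | (t : EReal) ≤ ramIndex K L σ}

/-- The function `φ_{L/K}(x) = (1 / n) ∫_0^x #Γ_t dt`, `n = [L : K]`. -/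
def hasseHerbrand (x : ℝ) : ℝ :=
  (1 / (Module.finrank K L : ℝ)) * ∫ t in (0 : ℝ)..x, ((ramSet K L t).ncard : ℝ)

/-- `τ_ℓ`, the smallest real `t ≥ 0` such that `n φ_{L/K}(x)` has slope `≤ p ^ ℓ` for `x ≥ t`. -/
def tau (p ℓ : ℕ) : ℝ :=
  sInf {t : ℝ | 0 ≤ t ∧ ∀ x y : ℝ, t ≤ x → x ≤ y →
    (Module.finrank K L : ℝ) * hasseHerbrand K L y - (Module.finrank K L : ℝ) * hasseHerbrand K L x
      ≤ (p : ℝ) ^ ℓ * (y - x)}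

/-- `ξ_ℓ = n φ_{L/K}(τ_ℓ) - p ^ ℓ τ_ℓ`. -/
def xi (p ℓ : ℕ) : ℝ :=
  (Module.finrank K L : ℝ) * hasseHerbrand K L (tau K L p ℓ) - (p : ℝ) ^ ℓ * tau K L p ℓ

/-- `P_q(w)`: the `𝒪_K`-module generated by the monomials `c T ^ i` with `q ∣ i` and
`v_L(c) + i ≥ w`. -/
def monomialModule (q : ℕ) (w : ℝ) : Submodule 𝒪[K] 𝒪[K][X] :=
  Submodule.span 𝒪[K]
    {h | ∃ (i : ℕ) (c : 𝒪[K]), q ∣ i ∧ (w : EReal) ≤ vExt K L (c : K) + (i : EReal) ∧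
      h = monomial i c}

/-- The Newton polygon of a polynomial `h` over `L` with respect to `v_L`, as a convex region of
the plane: the convex hull of the union of the quadrants `(k, v_L(h_k)) + ℝ_{≥0}²`, over the
nonzero coefficients `h_k` of `h` (recall that `v_L(0) = +∞`). -/
def newtonPolygon (h : L[X]) : Set (ℝ × ℝ) :=
  convexHull ℝ {q : ℝ × ℝ | ∃ k : ℕ, (k : ℝ) ≤ q.1 ∧ vExt K L (h.coeff k) ≤ (q.2 : EReal)}

end RamEisenstein

end

open RamEisenstein

/-! Write w_σ = v_L(σ(π)/π - 1). Expanding x in powers of π shows i(σ) = w_σ (`ramIndex_eq_weight`),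
so nφ(x) = Σ_σ min(x, w_σ) (`finrank_mul_hasseHerbrand`). On the other hand f(π + πT) = π^n ∏_σ (T -
(σ(π)/π - 1)), so nφ is, up to Legendre transform, the Newton polygon of f(π + πT): ξ_j + n is the
height of its lower boundary at abscissa p^j.

Coefficient bounds (`xi_add_le_coeff`). For k > 0 the k-th coefficient of f(π + πT) is the sum of
the f_i binom(i,k) π^i, whose valuations are distinct modulo n, so each term has at least the
valuation of the sum. With k = p^b and v_p(binom(i,p^b)) = v_p(i) - b this gives ξ_b + n ≤ v_L(f_i)
+ i + (v_p(i) - b)e, where e = v_L(p), possibly +∞.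

Congruence (`sub_mem_levelModule`). Write π = ρ(1 + u) with v_L(u) ≥ m, and u = U(ρ) with U over
𝒪_K, all terms being of valuation ≥ m. Then H = f(T(1 + U)) - f takes the value -f(ρ) at ρ, so f - g
+ (H mod g) has degree < n and vanishes at ρ: it is zero. If p^a ∣ i, then (1 + U)^i - 1 is a sum of
terms p^(a-b) c T^l with p^b ∣ l and v_L(c) + l ≥ p^b m, and the coefficient bounds place H in the
required module. Reduction modulo g preserves this module, by the same bounds for g.

Polygon (`coeff_comp_mem_newtonPolygon`). The points (p^j, ξ_j + n + p^j m) lie in the polygon of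
f(π + π^(m+1)T). A monomial cT^i of level j contributes c binom(i,k) π^i to the k-th coefficient. If
p^j ∣ k, this dominates the j-th point; otherwise a = v_p(k) < j, the binomial is divisible by
p^(j-a), and ξ_a ≤ ξ_j + (j - a)e (`xi_le_add_mul`) shows that the a-th point is dominated. -/

open ValuativeRel Polynomial

noncomputable section

namespace RamEisenstein

set_option linter.unusedSectionVars false

/-! ### The valuation of a local field and its extension to algebraic extensions. -/

section ExtendedValuation

section BaseValuation

variable {K : Type*} [Field K] [ValuativeRel K] [TopologicalSpace K] [IsNonarchimedeanLocalField K]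

lemma vBase_eq_intCast (x : K) : ∃ k : ℤ, vBase K x = k := ⟨_, rfl⟩

lemma vBase_mul {x y : K} (hx : x ≠ 0) (hy : y ≠ 0) :
    vBase K (x * y) = vBase K x + vBase K y := by
  unfold vBase
  rw [map_mul, map_mul, WithZero.log_mul (by simpa using hx) (by simpa using hy)]
  push_cast; ring

lemma vBase_one : vBase K 1 = 0 := by simp [vBase]

lemma vBase_nonneg_iff {x : K} (hx : x ≠ 0) : 0 ≤ vBase K x ↔ valuation K x ≤ 1 := by
  unfold vBase
  have h0 : IsNonarchimedeanLocalField.valueGroupWithZeroIsoInt K (valuation K x) ≠ 0 := by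
    simpa using hx
  rw [Int.cast_nonneg_iff, neg_nonneg, ← WithZero.log_one,
    WithZero.log_le_log h0 one_ne_zero,
    ← map_one (IsNonarchimedeanLocalField.valueGroupWithZeroIsoInt K)]
  exact map_le_map_iff (IsNonarchimedeanLocalField.valueGroupWithZeroIsoInt K)

lemma vBase_inv {x : K} (hx : x ≠ 0) : vBase K x⁻¹ = -vBase K x := by
  have := vBase_mul hx (inv_ne_zero hx)
  rw [mul_inv_cancel₀ hx, vBase_one] at this
  linarith

lemma vBase_neg (x : K) : vBase K (-x) = vBase K x := by
  simp [vBase, Valuation.map_neg]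

lemma exists_vBase_eq_one : ∃ x : K, x ≠ 0 ∧ vBase K x = 1 := by
  obtain ⟨y, hy⟩ := (IsNonarchimedeanLocalField.valueGroupWithZeroIsoInt K).surjective
    (WithZero.exp (-1 : ℤ))
  obtain ⟨x, rfl⟩ := ValuativeRel.valuation_surjective y
  change IsNonarchimedeanLocalField.valueGroupWithZeroIsoInt K (valuation K x) = _ at hy
  refine ⟨x, ?_, ?_⟩
  · rintro rfl
    rw [map_zero, map_zero] at hy
    exact WithZero.exp_ne_zero hy.symm
  · simp [vBase, hy]

lemma vBase_zpow {x : K} (hx : x ≠ 0) (k : ℤ) : vBase K (x ^ k) = k * vBase K x := by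
  have hnat : ∀ k : ℕ, vBase K (x ^ k) = k * vBase K x := by
    intro k
    induction k with
    | zero => simp [vBase_one]
    | succ k ih => rw [pow_succ, vBase_mul (pow_ne_zero _ hx) hx, ih]; push_cast; ring
  obtain ⟨k, rfl | rfl⟩ := k.eq_nat_or_neg
  · simpa using hnat k
  · rw [zpow_neg, vBase_inv (zpow_ne_zero _ hx)]
    simpa using hnat k

end BaseValuation

variable (K : Type*) [Field K] [ValuativeRel K] [TopologicalSpace K] [IsNonarchimedeanLocalField K]

/-- A field norm extending the valuation of a local field to an algebraic extension. -/
lemma exists_norm_extension (M : Type*) [Field M] [Algebra K M] [Algebra.IsAlgebraic K M] :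
    ∃ (b : ℝ) (N : M → ℝ), 1 < b ∧ N 0 = 0 ∧ N 1 = 1 ∧ (∀ x y, N (x * y) = N x * N y) ∧
      (∀ x y, N (x + y) ≤ max (N x) (N y)) ∧
      ∀ y ≠ 0, N y = b ^ (-(vBase K ((minpoly K y).coeff 0) / ((minpoly K y).natDegree : ℝ))) := by
  let := IsTopologicalAddGroup.rightUniformSpace K
  have := isUniformAddGroup_of_addCommGroup (G := K)
  let : (Valued.v (R := K) (Γ₀ := ValueGroupWithZero K)).RankOne :=
  { hom' := (IsRankLeOne.nonempty (R := K)).some.emb.comp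
      MonoidWithZeroHom.ValueGroup₀.embedding
    strictMono' := (IsRankLeOne.nonempty (R := K)).some.strictMono.comp
        MonoidWithZeroHom.ValueGroup₀.embedding_strictMono }
  let := Valued.toNontriviallyNormedField K (ValueGroupWithZero K)
  have hle (x : K) : ‖x‖ ≤ 1 ↔ valuation K x ≤ 1 := Valued.toNormedField.norm_le_one_iff
  have : CompleteSpace K := inferInstance
  obtain ⟨ϖ, hϖ0, hϖ⟩ := exists_vBase_eq_one (K := K)
  have hϖ1 : ‖ϖ‖ < 1 := by
    rw [← one_lt_inv₀ (norm_pos_iff.mpr hϖ0), ← norm_inv, ← not_le, hle,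
      ← vBase_nonneg_iff (inv_ne_zero hϖ0), vBase_inv hϖ0, hϖ]
    norm_num
  -- Dividing x by a power of ϖ leaves a unit, and units have norm 1.
  have hnorm (x : K) (hx : x ≠ 0) : ‖x‖ = ‖ϖ‖⁻¹ ^ (-vBase K x) := by
    obtain ⟨k, hk⟩ := vBase_eq_intCast x
    have hz : x * ϖ ^ (-k) ≠ 0 := mul_ne_zero hx (zpow_ne_zero _ hϖ0)
    have h0 : vBase K (x * ϖ ^ (-k)) = 0 := by
      rw [vBase_mul hx (zpow_ne_zero _ hϖ0), vBase_zpow hϖ0, hϖ, hk]; simp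
    have h1 : ‖x * ϖ ^ (-k)‖ ≤ 1 := by rw [hle, ← vBase_nonneg_iff hz, h0]
    have h2 : ‖(x * ϖ ^ (-k))⁻¹‖ ≤ 1 := by
      rw [hle, ← vBase_nonneg_iff (inv_ne_zero hz), vBase_inv hz, h0, neg_zero]
    rw [norm_inv] at h2
    have h3 : ‖x * ϖ ^ (-k)‖ = 1 :=
      le_antisymm h1 ((inv_le_one₀ (norm_pos_iff.mpr hz)).mp h2)
    rw [norm_mul, norm_zpow, zpow_neg,
      mul_inv_eq_one₀ (zpow_ne_zero _ (norm_ne_zero_iff.mpr hϖ0))] at h3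
    rw [h3, hk, Real.inv_rpow (norm_nonneg _), ← Real.rpow_neg (norm_nonneg _), neg_neg,
      Real.rpow_intCast]
  refine ⟨‖ϖ‖⁻¹, spectralNorm K M, (one_lt_inv₀ (norm_pos_iff.mpr hϖ0)).mpr hϖ1,
    spectralNorm_zero, spectralNorm_one, ?_, ?_, ?_⟩
  · exact fun x y => map_mul (spectralMulAlgNorm K M) x y
  · exact fun x y => isNonarchimedean_spectralNorm x y
  · intro y hy
    have hc : (minpoly K y).coeff 0 ≠ 0 :=
      minpoly.coeff_zero_ne_zero (Algebra.IsIntegral.isIntegral y) hy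
    rw [spectralNorm.spectralNorm_eq_norm_coeff_zero_rpow, hnorm _ hc,
      ← Real.rpow_mul (by positivity)]
    congr 1
    ring

variable (L : Type*) [Field L] [Algebra K L]

/-- The valuation `vExt`, as a function with values in `WithTop ℝ`. -/
def extValue {M : Type*} [Field M] [Algebra K M] (y : M) : WithTop ℝ :=
  open scoped Classical in
  if y = 0 then ⊤
  else (((Module.finrank K L : ℝ) * vBase K ((minpoly K y).coeff 0) /
    ((minpoly K y).natDegree : ℝ) : ℝ) : WithTop ℝ)

section

variable {M : Type*} [Field M] [Algebra K M]

/-- `EReal` is `WithBot (WithTop ℝ)` and the value `⊥` never occurs. Working in `WithTop ℝ` makes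
the infinite value absorbing for addition, as an additive valuation requires. -/
lemma vExt_eq_extValue (y : M) : vExt K L y = (WithBot.some (extValue K L y) : EReal) := by
  unfold vExt extValue
  split_ifs <;> rfl

variable {K L}

lemma coe_le_vExt_iff {y : M} {r : ℝ} :
    (r : EReal) ≤ vExt K L y ↔ (r : WithTop ℝ) ≤ extValue K L y := by
  rw [vExt_eq_extValue]
  exact WithBot.coe_le_coe

lemma vExt_le_coe_iff {y : M} {r : ℝ} :
    vExt K L y ≤ (r : EReal) ↔ extValue K L y ≤ (r : WithTop ℝ) := by
  rw [vExt_eq_extValue]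
  exact WithBot.coe_le_coe

/-- The value depends only on the minimal polynomial, hence is invariant under embeddings. -/
lemma extValue_map {M' : Type*} [Field M'] [Algebra K M'] (σ : M →ₐ[K] M') (y : M) :
    extValue K L (σ y) = extValue K L y := by
  unfold extValue
  by_cases hy : y = 0
  · simp [hy]
  · rw [if_neg hy, if_neg (by simpa using hy), minpoly.algHom_eq σ σ.injective]

lemma extValue_algebraMap {c : K} (hc : c ≠ 0) :
    extValue K L (algebraMap K M c) = ((Module.finrank K L * vBase K c : ℝ) : WithTop ℝ) := by
  unfold extValue
  have hA : minpoly K (algebraMap K M c) = X - C c := minpoly.eq_X_sub_C M c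
  rw [if_neg (by simpa using hc), hA]
  simp [vBase_neg]

end

/-- The valuation `vExt` on an algebraic extension of `K`, as an additive valuation. -/
def extValuation [FiniteDimensional K L] (M : Type*) [Field M] [Algebra K M]
    [Algebra.IsAlgebraic K M] : AddValuation M (WithTop ℝ) :=
  AddValuation.of (extValue K L) (by simp [extValue])
    (by
      rw [← map_one (algebraMap K M), extValue_algebraMap one_ne_zero, vBase_one]
      simp)
    (by
      obtain ⟨b, N, hb, h0, h1, hmul, hadd, hN⟩ := exists_norm_extension K M
      intro x y
      by_cases hx : x = 0
      · rw [hx, zero_add]; exact min_le_right _ _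
      by_cases hy : y = 0
      · rw [hy, add_zero]; exact min_le_left _ _
      by_cases hxy : x + y = 0
      · simp [hxy, extValue]
      have h := hadd x y
      have hd : (0 : ℝ) < Module.finrank K L := by exact_mod_cast Module.finrank_pos
      rw [hN x hx, hN y hy, hN _ hxy, le_max_iff, Real.rpow_le_rpow_left_iff hb,
        Real.rpow_le_rpow_left_iff hb, neg_le_neg_iff, neg_le_neg_iff] at h
      simp only [extValue, hx, hy, hxy, if_false, min_le_iff, WithTop.coe_le_coe, mul_div_assoc]
      exact h.imp (fun h => by gcongr) (fun h => by gcongr))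
    (by
      obtain ⟨b, N, hb, h0, h1, hmul, hadd, hN⟩ := exists_norm_extension K M
      intro x y
      by_cases hx : x = 0
      · subst hx; simp [extValue]
      by_cases hy : y = 0
      · subst hy; simp [extValue]
      have h := hmul x y
      rw [hN x hx, hN y hy, hN _ (mul_ne_zero hx hy), ← Real.rpow_add (by linarith),
        Real.rpow_right_inj (by linarith) hb.ne'] at h
      simp only [extValue, hx, hy, mul_ne_zero hx hy, if_false, mul_div_assoc]
      rw [← WithTop.coe_add, ← mul_add]
      congr 2
      linarith)

lemma extValuation_apply [FiniteDimensional K L] {M : Type*} [Field M] [Algebra K M]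
    [Algebra.IsAlgebraic K M] (y : M) : extValuation K L M y = extValue K L y := rfl

end ExtendedValuation

/-! ### Eisenstein polynomials, uniformizers and expansions in their powers. -/

section EisensteinRoots

variable {K : Type*} [Field K] [ValuativeRel K] [TopologicalSpace K] [IsNonarchimedeanLocalField K]

lemma coe_ne_zero_of_ne_zero {c : 𝒪[K]} (hc : c ≠ 0) : (c : K) ≠ 0 := by
  simpa using hc

lemma exists_vBase_eq_natCast {c : 𝒪[K]} (hc : c ≠ 0) : ∃ k : ℕ, vBase K c = k := by
  obtain ⟨k, hk⟩ := vBase_eq_intCast (c : K)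
  have h : 0 ≤ vBase K c := (vBase_nonneg_iff (coe_ne_zero_of_ne_zero hc)).mpr c.2
  rw [hk] at h ⊢
  lift k to ℕ using (by exact_mod_cast h)
  exact ⟨k, by simp⟩

lemma isUnit_iff_vBase_eq_zero {c : 𝒪[K]} (hc : c ≠ 0) : IsUnit c ↔ vBase K c = 0 := by
  have hc' := coe_ne_zero_of_ne_zero hc
  constructor
  · rintro ⟨u, rfl⟩
    have h1 : ((u : 𝒪[K]) : K) * ((u⁻¹ : 𝒪[K]ˣ) : 𝒪[K]) = 1 := by
      rw [← Subring.coe_mul, Units.mul_inv, Subring.coe_one]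
    obtain ⟨k, hk⟩ := exists_vBase_eq_natCast hc
    obtain ⟨l, hl⟩ := exists_vBase_eq_natCast (u⁻¹).ne_zero
    have h2 := vBase_mul hc' (coe_ne_zero_of_ne_zero (u⁻¹).ne_zero)
    rw [h1, vBase_one, hk, hl] at h2
    have h3 : k + l = 0 := by exact_mod_cast h2.symm
    rw [hk]
    exact_mod_cast (Nat.add_eq_zero_iff.mp h3).1
  · intro h
    have h1 : valuation K (c : K)⁻¹ ≤ 1 := by
      rw [← vBase_nonneg_iff (inv_ne_zero hc'), vBase_inv hc', h, neg_zero]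
    exact IsUnit.of_mul_eq_one ⟨(c : K)⁻¹, h1⟩ (Subtype.ext (mul_inv_cancel₀ hc'))

lemma one_le_vBase_of_mem {c : 𝒪[K]} (hc : c ≠ 0) (h : c ∈ 𝓂[K]) : 1 ≤ vBase K c := by
  rw [IsLocalRing.mem_maximalIdeal, mem_nonunits_iff, isUnit_iff_vBase_eq_zero hc] at h
  obtain ⟨k, hk⟩ := exists_vBase_eq_natCast hc
  rw [hk] at h ⊢
  exact_mod_cast Nat.one_le_iff_ne_zero.mpr (by exact_mod_cast h)

lemma vBase_eq_one_of_mem_of_notMem {c : 𝒪[K]} (h : c ∈ 𝓂[K]) (h2 : c ∉ 𝓂[K] ^ 2) :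
    c ≠ 0 ∧ vBase K c = 1 := by
  have hc : c ≠ 0 := fun h => h2 (h ▸ zero_mem _)
  refine ⟨hc, ?_⟩
  by_contra hne
  obtain ⟨k, hk⟩ := exists_vBase_eq_natCast hc
  have h1 := one_le_vBase_of_mem hc h
  rw [hk] at h1 hne
  have hk2 : 2 ≤ k := by
    have h3 : 1 ≤ k := by exact_mod_cast h1
    have h4 : k ≠ 1 := by exact_mod_cast hne
    omega
  obtain ⟨ϖ, hϖ0, hϖ⟩ := exists_vBase_eq_one (K := K)
  have hw : valuation K ϖ ≤ 1 := by rw [← vBase_nonneg_iff hϖ0, hϖ]; norm_num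
  have hϖ0' : (⟨ϖ, hw⟩ : 𝒪[K]) ≠ 0 := fun h => hϖ0 (congrArg Subtype.val h)
  have hm : (⟨ϖ, hw⟩ : 𝒪[K]) ∈ 𝓂[K] := by
    rw [IsLocalRing.mem_maximalIdeal, mem_nonunits_iff, isUnit_iff_vBase_eq_zero hϖ0']
    simp [hϖ]
  have hc' := coe_ne_zero_of_ne_zero hc
  have hd : valuation K ((c : K) * (ϖ ^ (2 : ℤ))⁻¹) ≤ 1 := by
    have h5 : (2 : ℝ) ≤ k := by exact_mod_cast hk2
    rw [← vBase_nonneg_iff (mul_ne_zero hc' (inv_ne_zero (zpow_ne_zero _ hϖ0))),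
      vBase_mul hc' (inv_ne_zero (zpow_ne_zero _ hϖ0)), vBase_inv (zpow_ne_zero _ hϖ0),
      vBase_zpow hϖ0, hϖ, hk]
    push_cast
    linarith
  have he : c = ⟨_, hd⟩ * (⟨ϖ, hw⟩ : 𝒪[K]) ^ 2 := by
    apply Subtype.ext
    have h6 : (ϖ : K) ^ 2 ≠ 0 := pow_ne_zero _ hϖ0
    change (c : K) = c * (ϖ ^ (2 : ℤ))⁻¹ * ϖ ^ 2
    rw [zpow_ofNat]
    field_simp
  apply h2
  rw [he]
  exact Ideal.mul_mem_left _ _ (Ideal.pow_mem_pow hm 2)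

section Eisenstein

variable {L : Type*} [Field L] [Algebra K L] {f : 𝒪[K][X]} {π : L}

lemma natDegree_pos_of_aeval_eq_zero (hf : f.Monic) (hπ : aeval π f = 0) : 0 < f.natDegree := by
  by_contra h
  rw [hf.natDegree_eq_zero.mp (by omega), map_one] at hπ
  exact one_ne_zero hπ

lemma map_eq_minpoly (hf : f.Monic) (hE : f.IsEisensteinAt 𝓂[K]) (hπ : aeval π f = 0) :
    f.map (algebraMap 𝒪[K] K) = minpoly K π := by
  refine minpoly.eq_of_irreducible_of_monic ?_ ?_ (hf.map _)
  · exact (Polynomial.Monic.irreducible_iff_irreducible_map_fraction_map hf).mp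
      (hE.irreducible inferInstance hf.isPrimitive (natDegree_pos_of_aeval_eq_zero hf hπ))
  · rwa [aeval_map_algebraMap]

lemma isIntegral_of_aeval_eq_zero (hf : f.Monic) (hπ : aeval π f = 0) : IsIntegral K π :=
  ⟨f.map (algebraMap 𝒪[K] K), hf.map _, by
    rw [← aeval_def, aeval_map_algebraMap]; exact hπ⟩

lemma natDegree_minpoly_eq (hf : f.Monic) (hE : f.IsEisensteinAt 𝓂[K]) (hπ : aeval π f = 0) :
    (minpoly K π).natDegree = f.natDegree := by
  rw [← map_eq_minpoly hf hE hπ, hf.natDegree_map]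

lemma finiteDimensional_of_adjoin_eq_top (hf : f.Monic) (hπ : aeval π f = 0)
    (hL : IntermediateField.adjoin K {π} = ⊤) : FiniteDimensional K L := by
  have h := IntermediateField.adjoin.finiteDimensional (isIntegral_of_aeval_eq_zero hf hπ)
  rw [hL] at h
  exact IntermediateField.topEquiv.toLinearEquiv.finiteDimensional

lemma finrank_eq_natDegree (hf : f.Monic) (hE : f.IsEisensteinAt 𝓂[K]) (hπ : aeval π f = 0)
    (hL : IntermediateField.adjoin K {π} = ⊤) : Module.finrank K L = f.natDegree := by
  rw [← natDegree_minpoly_eq hf hE hπ,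
    ← IntermediateField.adjoin.finrank (isIntegral_of_aeval_eq_zero hf hπ), hL,
    IntermediateField.finrank_top']

/-- This makes ρ a generator of L as well, by comparing degrees. -/
lemma adjoin_eq_top_of_natDegree_eq [FiniteDimensional K L] (hf : f.Monic)
    (hE : f.IsEisensteinAt 𝓂[K]) (hπ : aeval π f = 0) (hn : Module.finrank K L = f.natDegree) :
    IntermediateField.adjoin K {π} = ⊤ := by
  apply IntermediateField.eq_of_le_of_finrank_eq le_top
  rw [IntermediateField.adjoin.finrank (isIntegral_of_aeval_eq_zero hf hπ),
    IntermediateField.finrank_top', hn, natDegree_minpoly_eq hf hE hπ]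

/-- The norm of π is, up to sign, the constant term of f, which has valuation exactly 1 in K. -/
lemma extValue_root (hf : f.Monic) (hE : f.IsEisensteinAt 𝓂[K]) (hπ : aeval π f = 0)
    (hn : Module.finrank K L = f.natDegree) : extValue K L π = ((1 : ℝ) : WithTop ℝ) := by
  have hpos := natDegree_pos_of_aeval_eq_zero hf hπ
  obtain ⟨h0, h1⟩ := vBase_eq_one_of_mem_of_notMem (hE.mem hpos) hE.notMem
  have hπ0 : π ≠ 0 := by
    rintro rfl
    rw [aeval_def, eval₂_at_zero] at hπ
    exact coe_ne_zero_of_ne_zero h0 ((map_eq_zero (algebraMap K L)).mp hπ)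
  unfold extValue
  rw [if_neg hπ0, ← map_eq_minpoly hf hE hπ, hf.natDegree_map, coeff_map]
  have h2 : algebraMap 𝒪[K] K (f.coeff 0) = (f.coeff 0 : K) := rfl
  rw [h2, h1, hn, mul_one, div_self (by exact_mod_cast hpos.ne')]

lemma extValue_algebraMap_integer {M : Type*} [Field M] [Algebra K M] {c : 𝒪[K]} (hc : c ≠ 0) :
    extValue K L (algebraMap 𝒪[K] M c) =
      ((Module.finrank K L * vBase K (c : K) : ℝ) : WithTop ℝ) :=
  extValue_algebraMap (coe_ne_zero_of_ne_zero hc)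

lemma extValue_algebraMap_integer_nonneg {M : Type*} [Field M] [Algebra K M] (c : 𝒪[K]) :
    0 ≤ extValue K L (algebraMap 𝒪[K] M c) := by
  by_cases hc : c = 0
  · simp [hc, extValue]
  · rw [extValue_algebraMap_integer hc]
    have := (vBase_nonneg_iff (coe_ne_zero_of_ne_zero hc)).mpr c.2
    exact_mod_cast mul_nonneg (Nat.cast_nonneg _) this

lemma le_extValue_of_mem_maximalIdeal {M : Type*} [Field M] [Algebra K M] {c : 𝒪[K]}
    (hc : c ∈ 𝓂[K]) : ((Module.finrank K L : ℝ) : WithTop ℝ) ≤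
      extValue K L (algebraMap 𝒪[K] M c) := by
  by_cases hc0 : c = 0
  · simp [hc0, extValue]
  · rw [extValue_algebraMap_integer hc0, WithTop.coe_le_coe]
    exact le_mul_of_one_le_right (Nat.cast_nonneg _) (one_le_vBase_of_mem hc0 hc)

end Eisenstein

/-- A sum of terms of distinct valuations has at most the valuation of any of them. -/
lemma valuation_sum_le_of_pairwise_ne {M : Type*} [Field M] (v : AddValuation M (WithTop ℝ))
    {ι : Type*} (s : Finset ι) (t : ι → M)
    (h : ∀ i ∈ s, ∀ j ∈ s, i ≠ j → t i ≠ 0 → v (t i) ≠ v (t j)) {i : ι} (hi : i ∈ s) :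
    v (∑ j ∈ s, t j) ≤ v (t i) := by
  classical
  -- The second conjunct strengthens the induction: a nonzero partial sum has the valuation of one
  -- of its terms, hence one different from that of the next term.
  have key : (∀ i ∈ s, v (∑ j ∈ s, t j) ≤ v (t i)) ∧
      (∑ j ∈ s, t j = 0 ∨ ∃ j ∈ s, v (∑ j ∈ s, t j) = v (t j)) := by
    clear hi i
    induction s using Finset.induction_on with
    | empty => simp
    | insert a s ha ih =>
      obtain ⟨ih1, ih2⟩ := ih (fun i hi j hj => h i (Finset.mem_insert_of_mem hi) j
        (Finset.mem_insert_of_mem hj))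
      rw [Finset.sum_insert ha]
      by_cases hta : t a = 0
      · rw [hta, zero_add]
        refine ⟨fun i hi => ?_, ih2.imp_right ?_⟩
        · rcases Finset.mem_insert.mp hi with rfl | hi
          · simp [hta]
          · exact ih1 i hi
        · rintro ⟨j, hj, hj'⟩
          exact ⟨j, Finset.mem_insert_of_mem hj, hj'⟩
      have hne : v (t a) ≠ v (∑ j ∈ s, t j) := by
        rcases ih2 with h0 | ⟨j, hj, hj'⟩
        · rw [h0, AddValuation.map_zero]
          exact (AddValuation.ne_top_iff v).mpr hta
        · rw [hj']
          exact h a (Finset.mem_insert_self _ _) j (Finset.mem_insert_of_mem hj)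
            (by rintro rfl; exact ha hj) hta
      rw [AddValuation.map_add_of_distinct_val v hne]
      refine ⟨fun i hi => ?_, Or.inr ?_⟩
      · rcases Finset.mem_insert.mp hi with rfl | hi
        · exact min_le_left _ _
        · exact (min_le_right _ _).trans (ih1 i hi)
      · rcases ih2 with h0 | ⟨j, hj, hj'⟩
        · exact ⟨a, Finset.mem_insert_self _ _, by simp [h0]⟩
        · rcases min_choice (v (t a)) (v (∑ j ∈ s, t j)) with h1 | h1
          · exact ⟨a, Finset.mem_insert_self _ _, h1⟩
          · exact ⟨j, Finset.mem_insert_of_mem hj, h1.trans hj'⟩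
  exact key.1 i hi

section Expansion

variable {L : Type*} [Field L] [Algebra K L] [FiniteDimensional K L] {π : L}

lemma valuation_eq_of_extValue_eq_one (hπ : extValue K L π = ((1 : ℝ) : WithTop ℝ)) (i : ℕ) :
    extValuation K L L (π ^ i) = ((i : ℝ) : WithTop ℝ) := by
  rw [AddValuation.map_pow, extValuation_apply, hπ, ← WithTop.coe_nsmul]
  simp

/-- The j-th term has valuation n v_K(c_j) + j with j < n, so nonzero terms have valuations distinct
modulo n. -/
lemma extValuation_sum_le (hπ : extValue K L π = ((1 : ℝ) : WithTop ℝ))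
    (c : ℕ → K) {i : ℕ} (hi : i < Module.finrank K L) :
    extValuation K L L (∑ j ∈ Finset.range (Module.finrank K L), algebraMap K L (c j) * π ^ j) ≤
      extValuation K L L (algebraMap K L (c i) * π ^ i) := by
  have hπ0 : π ≠ 0 := by rintro rfl; simp [extValue] at hπ
  refine valuation_sum_le_of_pairwise_ne _ _ _ ?_ (Finset.mem_range.mpr hi)
  intro i hi j hj hij hti heq
  have hci : c i ≠ 0 := by rintro h; simp [h] at hti
  have hcj : c j ≠ 0 := by
    rintro h
    rw [h, map_zero, zero_mul, AddValuation.map_zero, AddValuation.top_iff] at heq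
    exact hti heq
  rw [AddValuation.map_mul, AddValuation.map_mul, valuation_eq_of_extValue_eq_one hπ,
    valuation_eq_of_extValue_eq_one hπ, extValuation_apply, extValuation_apply,
    extValue_algebraMap hci, extValue_algebraMap hcj] at heq
  obtain ⟨k, hk⟩ := vBase_eq_intCast (c i)
  obtain ⟨l, hl⟩ := vBase_eq_intCast (c j)
  rw [hk, hl] at heq
  have h1 : (Module.finrank K L : ℤ) * k + i = Module.finrank K L * l + j := by exact_mod_cast heq
  have h2 : (i : ℤ) % (Module.finrank K L : ℤ) = j % (Module.finrank K L : ℤ) := by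
    have := congrArg (· % (Module.finrank K L : ℤ)) h1
    simpa using this
  rw [Finset.mem_range] at hi hj
  rw [Int.emod_eq_of_lt (by positivity) (by exact_mod_cast hi),
    Int.emod_eq_of_lt (by positivity) (by exact_mod_cast hj)] at h2
  exact hij (by exact_mod_cast h2)

lemma exists_aeval_eq_of_adjoin_eq_top (hL : IntermediateField.adjoin K {π} = ⊤) (u : L) :
    ∃ q : K[X], aeval π q = u := by
  have h1 : u ∈ (IntermediateField.adjoin K {π}).toSubalgebra := by
    rw [hL]; exact IntermediateField.mem_top
  rw [IntermediateField.adjoin_simple_toSubalgebra_of_isAlgebraic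
    (Algebra.IsAlgebraic.isAlgebraic π), Algebra.adjoin_singleton_eq_range_aeval] at h1
  exact h1

lemma exists_expansion (hL : IntermediateField.adjoin K {π} = ⊤) (u : L) :
    ∃ r : K[X], r.natDegree < Module.finrank K L ∧ aeval π r = u := by
  have hint : IsIntegral K π := Algebra.IsIntegral.isIntegral π
  have hrank : (minpoly K π).natDegree = Module.finrank K L := by
    rw [← IntermediateField.adjoin.finrank hint, hL, IntermediateField.finrank_top']
  obtain ⟨q, hq⟩ := exists_aeval_eq_of_adjoin_eq_top hL u
  refine ⟨q %ₘ minpoly K π, ?_, ?_⟩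
  · rw [← hrank]
    exact natDegree_modByMonic_lt _ (minpoly.monic hint) (minpoly.ne_one K π)
  · rw [aeval_modByMonic_eq_self_of_root (minpoly.aeval K π), hq]

/-- An element of `L` of valuation at least `m ≥ 0` is the value at a uniformizer generating `L`
of a polynomial over `𝒪[K]`, all of whose terms have valuation at least `m`. -/
lemma exists_integer_expansion (hπ : extValue K L π = ((1 : ℝ) : WithTop ℝ))
    (hL : IntermediateField.adjoin K {π} = ⊤) {m : ℝ} (hm : 0 ≤ m) {u : L}
    (hu : (m : WithTop ℝ) ≤ extValuation K L L u) :
    ∃ U : 𝒪[K][X], U.natDegree < Module.finrank K L ∧ aeval π U = u ∧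
      ∀ l, (m : WithTop ℝ) ≤ extValuation K L L (algebraMap 𝒪[K] L (U.coeff l) * π ^ l) := by
  obtain ⟨r, hrd, hru⟩ := exists_expansion hL u
  have hval (l : ℕ) (hl : l < Module.finrank K L) :
      (m : WithTop ℝ) ≤ extValuation K L L (algebraMap K L (r.coeff l) * π ^ l) := by
    refine hu.trans ?_
    rw [← hru, aeval_eq_sum_range' hrd]
    simp_rw [Algebra.smul_def]
    exact extValuation_sum_le hπ _ hl
  -- From 0 ≤ n v_K(c_l) + l and l < n the integer v_K(c_l) exceeds -1.
  have hcoef (l : ℕ) : valuation K (r.coeff l) ≤ 1 := by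
    by_cases h0 : r.coeff l = 0
    · simp [h0]
    have hl : l < Module.finrank K L := lt_of_le_of_lt (le_natDegree_of_ne_zero h0) hrd
    have h1 := hval l hl
    rw [AddValuation.map_mul, valuation_eq_of_extValue_eq_one hπ, extValuation_apply,
      extValue_algebraMap h0, ← WithTop.coe_add, WithTop.coe_le_coe] at h1
    rw [← vBase_nonneg_iff h0]
    obtain ⟨k, hk⟩ := vBase_eq_intCast (r.coeff l)
    rw [hk] at h1 ⊢
    have h2 : (0 : ℤ) ≤ Module.finrank K L * k + l := by exact_mod_cast hm.trans h1
    by_contra hneg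
    have h3 : k ≤ -1 := by
      have : ¬ (0 : ℤ) ≤ k := by exact_mod_cast hneg
      omega
    have h4 : (l : ℤ) < Module.finrank K L := by exact_mod_cast hl
    nlinarith
  have hlift : r ∈ Polynomial.lifts (algebraMap 𝒪[K] K) := by
    rw [lifts_iff_coeff_lifts]
    exact fun l => ⟨⟨r.coeff l, hcoef l⟩, rfl⟩
  obtain ⟨U, hU, hUd⟩ := exists_natDegree_eq_of_mem_lifts hlift
  refine ⟨U, hUd ▸ hrd, ?_, fun l => ?_⟩
  · rw [← hru, ← hU, aeval_map_algebraMap]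
  · by_cases hl : l < Module.finrank K L
    · have h1 := hval l hl
      rwa [← hU, coeff_map, ← IsScalarTower.algebraMap_apply] at h1
    · rw [coeff_eq_zero_of_natDegree_lt (by omega)]
      simp

end Expansion

end EisensteinRoots

/-! ### Sums of truncations and Newton polygons of products of linear factors. -/

section SlopeData

/-- The real number `min x a`. -/
def trunc (x : ℝ) (a : WithTop ℝ) : ℝ := (min (x : WithTop ℝ) a).untopD 0

lemma trunc_top (x : ℝ) : trunc x ⊤ = x := by simp [trunc]

lemma trunc_coe (x a : ℝ) : trunc x (a : WithTop ℝ) = min x a := by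
  rw [trunc, ← WithTop.coe_min, WithTop.untopD_coe]

lemma coe_trunc (x : ℝ) (a : WithTop ℝ) : (trunc x a : WithTop ℝ) = min (x : WithTop ℝ) a := by
  cases a with
  | top => simp [trunc_top]
  | coe a => rw [trunc_coe, WithTop.coe_min]

lemma trunc_le_left (x : ℝ) (a : WithTop ℝ) : trunc x a ≤ x := by
  rw [← WithTop.coe_le_coe, coe_trunc]; exact min_le_left _ _

lemma coe_trunc_le (x : ℝ) (a : WithTop ℝ) : (trunc x a : WithTop ℝ) ≤ a := by
  rw [coe_trunc]; exact min_le_right _ _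

lemma trunc_of_le {x : ℝ} {a : WithTop ℝ} (h : (x : WithTop ℝ) ≤ a) : trunc x a = x := by
  rw [← WithTop.coe_inj, coe_trunc, min_eq_left h]

lemma coe_trunc_of_le {x : ℝ} {a : WithTop ℝ} (h : a ≤ (x : WithTop ℝ)) :
    (trunc x a : WithTop ℝ) = a := by
  rw [coe_trunc, min_eq_right h]

lemma trunc_eq_trunc {x y : ℝ} {a : WithTop ℝ} (hx : a ≤ (x : WithTop ℝ))
    (hy : a ≤ (y : WithTop ℝ)) : trunc x a = trunc y a := by
  rw [← WithTop.coe_inj, coe_trunc_of_le hx, coe_trunc_of_le hy]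

lemma trunc_mono {x y : ℝ} (h : x ≤ y) (a : WithTop ℝ) : trunc x a ≤ trunc y a := by
  rw [← WithTop.coe_le_coe, coe_trunc, coe_trunc]
  exact min_le_min_right _ (by exact_mod_cast h)

lemma trunc_sub_trunc_le {x y : ℝ} (h : x ≤ y) (a : WithTop ℝ) : trunc y a - trunc x a ≤ y - x := by
  cases a with
  | top => simp [trunc_top]
  | coe a =>
    rw [trunc_coe, trunc_coe]
    rcases min_cases y a with h1 | h1 <;> rcases min_cases x a with h2 | h2 <;> linarith

section Weights

variable {ι : Type*} [Fintype ι] (w : ι → WithTop ℝ)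

/-- The concave function `x ↦ ∑ i, min x (w i)`. -/
def truncSum (x : ℝ) : ℝ := ∑ i, trunc x (w i)

/-- The smallest `t ≥ 0` from which on `truncSum w` has slope at most `q`. -/
def slopeBreak (q : ℝ) : ℝ :=
  sInf {t : ℝ | 0 ≤ t ∧ ∀ x y : ℝ, t ≤ x → x ≤ y →
    truncSum w y - truncSum w x ≤ q * (y - x)}

/-- The intercept of the line of slope `q` supporting the graph of `truncSum w`. -/
def slopeIntercept (q : ℝ) : ℝ := truncSum w (slopeBreak w q) - q * slopeBreak w q

open scoped Classical in
/-- The number of weights that are at least `x`. -/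
def countGE (x : ℝ) : ℕ := (Finset.univ.filter fun i => (x : WithTop ℝ) ≤ w i).card

open scoped Classical in
/-- The number of weights that are larger than `x`. -/
def countGT (x : ℝ) : ℕ := (Finset.univ.filter fun i => (x : WithTop ℝ) < w i).card

variable {w}

lemma truncSum_sub_le {x y : ℝ} (h : x ≤ y) :
    truncSum w y - truncSum w x ≤ countGT w x * (y - x) := by
  classical
  rw [truncSum, truncSum, ← Finset.sum_sub_distrib, countGT, Finset.card_filter, Nat.cast_sum,
    Finset.sum_mul]
  refine Finset.sum_le_sum fun i _ => ?_
  split_ifs with hi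
  · simpa using trunc_sub_trunc_le h (w i)
  · rw [not_lt] at hi
    rw [trunc_eq_trunc hi (hi.trans (by exact_mod_cast h))]
    simp

lemma le_truncSum_sub {x y : ℝ} (h : x ≤ y) :
    countGE w y * (y - x) ≤ truncSum w y - truncSum w x := by
  classical
  rw [truncSum, truncSum, ← Finset.sum_sub_distrib, countGE, Finset.card_filter, Nat.cast_sum,
    Finset.sum_mul]
  refine Finset.sum_le_sum fun i _ => ?_
  split_ifs with hi
  · rw [trunc_of_le hi, trunc_of_le (le_trans (by exact_mod_cast h) hi)]
    simp
  · have := trunc_mono h (w i)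
    simp only [Nat.cast_zero, zero_mul]
    linarith

/-- Just above `x`, no weight occurs. -/
lemma exists_gap_above (w : ι → WithTop ℝ) (x : ℝ) : ∃ c > x, ∀ c', x < c' → c' ≤ c →
    countGE w c' = countGT w x ∧ countGT w c' = countGT w x ∧ ∀ i, w i ≠ c' := by
  classical
  have h : ∃ c > x, ∀ i, (x : WithTop ℝ) < w i → (c : WithTop ℝ) < w i := by
    have h1 : ∀ i, ∃ c > x, (x : WithTop ℝ) < w i → (c : WithTop ℝ) < w i := by
      intro i
      by_cases hi : (x : WithTop ℝ) < w i
      · cases hwi : w i with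
        | top => exact ⟨x + 1, by linarith, fun _ => WithTop.coe_lt_top _⟩
        | coe a =>
          rw [hwi, WithTop.coe_lt_coe] at hi
          exact ⟨(x + a) / 2, by linarith, fun _ => by rw [WithTop.coe_lt_coe]; linarith⟩
      · exact ⟨x + 1, by linarith, fun h => absurd h hi⟩
    choose c hc hc' using h1
    rcases isEmpty_or_nonempty ι with hι | hι
    · exact ⟨x + 1, by linarith, fun i => (hι.false i).elim⟩
    · obtain ⟨i, hi⟩ := Finite.exists_min c
      refine ⟨c i, hc i, fun j hj => lt_of_le_of_lt ?_ (hc' j hj)⟩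
      exact_mod_cast hi j
  obtain ⟨c, hc, hcw⟩ := h
  refine ⟨c, hc, fun c' h1 h2 => ⟨?_, ?_, ?_⟩⟩
  · refine congrArg Finset.card (Finset.filter_congr fun i _ => ⟨fun h => ?_, fun h => ?_⟩)
    · exact lt_of_lt_of_le (by exact_mod_cast h1) h
    · exact le_trans (by exact_mod_cast h2) (hcw i h).le
  · refine congrArg Finset.card (Finset.filter_congr fun i _ => ⟨fun h => ?_, fun h => ?_⟩)
    · exact lt_trans (by exact_mod_cast h1) h
    · exact lt_of_le_of_lt (by exact_mod_cast h2) (hcw i h)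
  · intro i hi
    have h3 : (c : WithTop ℝ) < w i := hcw i (by rw [hi]; exact_mod_cast h1)
    rw [hi, WithTop.coe_lt_coe] at h3
    linarith

/-- Just below `x`, no weight occurs. -/
lemma exists_gap_below (w : ι → WithTop ℝ) (x : ℝ) : ∃ c < x, ∀ c', c ≤ c' → c' < x →
    countGT w c' = countGE w x ∧ ∀ i, w i ≠ c' := by
  classical
  have h : ∃ c < x, ∀ i, w i < (x : WithTop ℝ) → w i < (c : WithTop ℝ) := by
    have h1 : ∀ i, ∃ c < x, w i < (x : WithTop ℝ) → w i < (c : WithTop ℝ) := by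
      intro i
      by_cases hi : w i < (x : WithTop ℝ)
      · cases hwi : w i with
        | top => rw [hwi] at hi; exact absurd hi not_top_lt
        | coe a =>
          rw [hwi, WithTop.coe_lt_coe] at hi
          exact ⟨(x + a) / 2, by linarith, fun _ => by rw [WithTop.coe_lt_coe]; linarith⟩
      · exact ⟨x - 1, by linarith, fun h => absurd h hi⟩
    choose c hc hc' using h1
    rcases isEmpty_or_nonempty ι with hι | hι
    · exact ⟨x - 1, by linarith, fun i => (hι.false i).elim⟩
    · obtain ⟨i, hi⟩ := Finite.exists_max c
      refine ⟨c i, hc i, fun j hj => lt_of_lt_of_le (hc' j hj) ?_⟩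
      exact_mod_cast hi j
  obtain ⟨c, hc, hcw⟩ := h
  refine ⟨c, hc, fun c' h1 h2 => ⟨?_, ?_⟩⟩
  · refine congrArg Finset.card (Finset.filter_congr fun i _ => ⟨fun h => ?_, fun h => ?_⟩)
    · by_contra h3
      have h4 := hcw i (not_le.mp h3)
      exact absurd (h.trans h4) (not_lt.mpr (by exact_mod_cast h1))
    · exact lt_of_lt_of_le (by exact_mod_cast h2) h
  · intro i hi
    have h3 : w i < (c : WithTop ℝ) := hcw i (by rw [hi]; exact_mod_cast h2)
    rw [hi, WithTop.coe_lt_coe] at h3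
    linarith

lemma countGT_anti {x y : ℝ} (h : x ≤ y) : countGT w y ≤ countGT w x := by
  classical
  exact Finset.card_le_card (Finset.monotone_filter_right _ fun i _ hi =>
    lt_of_le_of_lt (by exact_mod_cast h) hi)

lemma countGE_eq_card {x : ℝ} (h : ∀ i, (x : WithTop ℝ) ≤ w i) : countGE w x = Fintype.card ι := by
  classical
  rw [countGE, Finset.filter_true_of_mem fun i _ => h i, Finset.card_univ]

/-- The function is concave and its right slope at t is the number of weights larger than t. -/
lemma mem_slopeSet_iff {q t : ℝ} : (∀ x y : ℝ, t ≤ x → x ≤ y →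
    truncSum w y - truncSum w x ≤ q * (y - x)) ↔ (countGT w t : ℝ) ≤ q := by
  constructor
  · intro h
    obtain ⟨c, hc, hgap⟩ := exists_gap_above w t
    have h1 := h t c le_rfl hc.le
    have h2 := le_truncSum_sub (w := w) hc.le
    rw [(hgap c hc le_rfl).1] at h2
    exact le_of_mul_le_mul_right (h2.trans h1) (sub_pos.mpr hc)
  · intro h x y hx hxy
    refine (truncSum_sub_le hxy).trans ?_
    refine mul_le_mul_of_nonneg_right (le_trans ?_ h) (sub_nonneg.mpr hxy)
    exact_mod_cast countGT_anti hx

lemma slopeBreak_eq (q : ℝ) :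
    slopeBreak w q = sInf {t : ℝ | 0 ≤ t ∧ (countGT w t : ℝ) ≤ q} := by
  simp only [slopeBreak, mem_slopeSet_iff]

lemma slopeBreak_nonneg (q : ℝ) : 0 ≤ slopeBreak w q :=
  Real.sInf_nonneg fun _ h => h.1

/-- Beyond the largest finite weight only the infinite weights still contribute to the slope. -/
lemma exists_countGT_le (q : ℝ) (hq : ({i | w i = ⊤} : Set ι).ncard ≤ q) :
    ∃ t : ℝ, 0 ≤ t ∧ (countGT w t : ℝ) ≤ q := by
  classical
  have h1 : ∃ t : ℝ, 0 ≤ t ∧ ∀ i, w i ≠ ⊤ → w i ≤ (t : WithTop ℝ) := by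
    rcases isEmpty_or_nonempty ι with hι | hι
    · exact ⟨0, le_rfl, fun i => (hι.false i).elim⟩
    · obtain ⟨i, hi⟩ := Finite.exists_max fun i => (w i).untopD 0
      refine ⟨max 0 ((w i).untopD 0), le_max_left _ _, fun j hj => ?_⟩
      lift w j to ℝ using hj with a ha
      rw [WithTop.coe_le_coe]
      have := hi j
      simp only [← ha, WithTop.untopD_coe] at this
      exact this.trans (le_max_right _ _)
  obtain ⟨t, ht0, ht⟩ := h1
  refine ⟨t, ht0, le_trans ?_ hq⟩
  rw [countGT, ← Set.ncard_coe_finset]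
  refine Nat.cast_le.mpr (Set.ncard_le_ncard (fun i hi => ?_) (Set.toFinite _))
  by_contra h
  exact absurd (ht i h) (not_le.mpr (by simpa using hi))

lemma countGT_slopeBreak_le {q : ℝ} (hq : ({i | w i = ⊤} : Set ι).ncard ≤ q) :
    (countGT w (slopeBreak w q) : ℝ) ≤ q := by
  obtain ⟨c, hc, hgap⟩ := exists_gap_above w (slopeBreak w q)
  have hne : {t : ℝ | 0 ≤ t ∧ (countGT w t : ℝ) ≤ q}.Nonempty := exists_countGT_le q hq
  obtain ⟨t, ht, htc⟩ := exists_lt_of_csInf_lt hne (by rwa [← slopeBreak_eq])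
  rw [← (hgap c hc le_rfl).2.1]
  exact le_trans (by exact_mod_cast countGT_anti htc.le) ht.2

lemma lt_countGE_slopeBreak {q : ℝ} (h : 0 < slopeBreak w q) :
    q < countGE w (slopeBreak w q) := by
  by_contra hlt
  rw [not_lt] at hlt
  obtain ⟨c, hc, hgap⟩ := exists_gap_below w (slopeBreak w q)
  have hc' := max_lt hc h
  rw [← (hgap (max c 0) (le_max_left _ _) hc').1] at hlt
  have : slopeBreak w q ≤ max c 0 := by
    conv_lhs => rw [slopeBreak_eq]
    exact csInf_le ⟨0, fun _ h => h.1⟩ ⟨le_max_right _ _, hlt⟩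
  linarith

lemma le_countGE_slopeBreak (hw : ∀ i, 0 ≤ w i) {q : ℝ} (hq : q ≤ Fintype.card ι) :
    q ≤ countGE w (slopeBreak w q) := by
  rcases (slopeBreak_nonneg (w := w) q).eq_or_lt with h | h
  · rw [← h, countGE_eq_card (by simpa using hw)]
    exact hq
  · exact (lt_countGE_slopeBreak h).le

/-- At the break, q lies between the right slope and the left slope, so by concavity the intercept
is the maximum of `truncSum w t - q * t`: a Legendre transform. -/
lemma truncSum_sub_le_slopeIntercept (hw : ∀ i, 0 ≤ w i) {q : ℝ} (hq : q ≤ Fintype.card ι)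
    (hq' : ({i | w i = ⊤} : Set ι).ncard ≤ q) (t : ℝ) :
    truncSum w t - q * t ≤ slopeIntercept w q := by
  unfold slopeIntercept
  rcases le_total t (slopeBreak w q) with h | h
  · have h1 := le_truncSum_sub (w := w) h
    have h2 := mul_le_mul_of_nonneg_right (le_countGE_slopeBreak hw hq) (sub_nonneg.mpr h)
    linarith
  · have h1 := truncSum_sub_le (w := w) h
    have h2 := mul_le_mul_of_nonneg_right (countGT_slopeBreak_le hq') (sub_nonneg.mpr h)
    linarith

lemma truncSum_zero (hw : ∀ i, 0 ≤ w i) : truncSum w 0 = 0 :=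
  Finset.sum_eq_zero fun i _ => trunc_of_le (by simpa using hw i)

lemma slopeIntercept_nonneg (hw : ∀ i, 0 ≤ w i) {q : ℝ} (hq : q ≤ Fintype.card ι)
    (hq' : ({i | w i = ⊤} : Set ι).ncard ≤ q) : 0 ≤ slopeIntercept w q := by
  simpa [truncSum_zero hw] using truncSum_sub_le_slopeIntercept hw hq hq' 0

end Weights

section Product

variable {M : Type*} [Field M] (v : AddValuation M (WithTop ℝ)) {ι : Type*} [Fintype ι] (a : ι → M)

lemma map_prod_eq_sum (s : Finset ι) : v (∏ i ∈ s, -a i) = ∑ i ∈ s, v (a i) := by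
  classical
  induction s using Finset.induction_on with
  | empty => simp
  | insert j s hj ih =>
    rw [Finset.prod_insert hj, Finset.sum_insert hj, AddValuation.map_mul, ih, AddValuation.map_neg]

lemma coeff_prod_X_sub_C {k : ℕ} (hk : k ≤ Fintype.card ι) :
    (∏ i, (X - C (a i))).coeff k =
      ∑ t ∈ Finset.powersetCard (Fintype.card ι - k) Finset.univ, ∏ i ∈ t, -a i := by
  have h := Finset.prod_X_add_C_coeff Finset.univ (fun i => -a i) (k := k) hk
  simpa [sub_eq_add_neg] using h

lemma sum_trunc_le_map_prod (x : ℝ) (t : Finset ι) :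
    ((∑ i ∈ t, trunc x (v (a i)) : ℝ) : WithTop ℝ) ≤ v (∏ i ∈ t, -a i) := by
  rw [map_prod_eq_sum, WithTop.coe_sum]
  exact Finset.sum_le_sum fun i _ => coe_trunc_le _ _

/-- Each term of the elementary symmetric function omits k of the weights, and truncated at x these
account for at most kx. -/
lemma truncSum_sub_le_coeff (x : ℝ) (k : ℕ) :
    ((truncSum (fun i => v (a i)) x - k * x : ℝ) : WithTop ℝ) ≤
      v ((∏ i, (X - C (a i))).coeff k) := by
  classical
  by_cases hk : k ≤ Fintype.card ι
  · rw [coeff_prod_X_sub_C a hk]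
    refine AddValuation.map_le_sum v fun t ht => le_trans ?_ (sum_trunc_le_map_prod v a x t)
    rw [Finset.mem_powersetCard] at ht
    rw [WithTop.coe_le_coe, truncSum, ← Finset.sum_add_sum_compl t]
    have h1 : ∑ i ∈ tᶜ, trunc x (v (a i)) ≤ (tᶜ.card : ℝ) * x := by
      rw [← nsmul_eq_mul]
      exact Finset.sum_le_card_nsmul _ _ _ fun i _ => trunc_le_left _ _
    have h2 : tᶜ.card = k := by rw [Finset.card_compl, ht.2]; omega
    rw [h2] at h1
    linarith
  · rw [coeff_eq_zero_of_natDegree_lt]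
    · simp
    · rw [natDegree_prod_of_monic _ _ fun i _ => monic_X_sub_C _]
      simpa using hk

/-- When c is not a weight, a single term of the symmetric function has minimal valuation: the
product over the indices of weight below c. Any other subset of that size exchanges some of them for
weights above c. -/
lemma coeff_countGT_eq {c : ℝ} (hc : ∀ i, v (a i) ≠ c) :
    v ((∏ i, (X - C (a i))).coeff (countGT (fun i => v (a i)) c)) =
      ((truncSum (fun i => v (a i)) c - countGT (fun i => v (a i)) c * c : ℝ) : WithTop ℝ) := by
  classical
  set A := Finset.univ.filter fun i => (c : WithTop ℝ) < v (a i) with hA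
  have hAk : countGT (fun i => v (a i)) c = A.card := by
    rw [countGT, hA]
  rw [hAk, coeff_prod_X_sub_C a (Finset.card_le_univ A)]
  have hmem : Aᶜ ∈ Finset.powersetCard (Fintype.card ι - A.card) Finset.univ := by
    rw [Finset.mem_powersetCard]
    exact ⟨Finset.subset_univ _, Finset.card_compl A⟩
  have hle {i : ι} (hi : i ∈ Aᶜ) : v (a i) < (c : WithTop ℝ) := by
    simp only [hA, Finset.mem_compl, Finset.mem_filter, Finset.mem_univ, true_and, not_lt] at hi
    exact lt_of_le_of_ne hi (hc i)
  have hsum : truncSum (fun i => v (a i)) c - A.card * c = ∑ i ∈ Aᶜ, trunc c (v (a i)) := by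
    rw [truncSum, ← Finset.sum_add_sum_compl A, Finset.sum_congr rfl (g := fun _ => c)]
    · simp
    · intro i hi
      exact trunc_of_le (Finset.mem_filter.mp hi).2.le
  have hmain : v (∏ i ∈ Aᶜ, -a i) = ((∑ i ∈ Aᶜ, trunc c (v (a i)) : ℝ) : WithTop ℝ) := by
    rw [map_prod_eq_sum, WithTop.coe_sum]
    exact Finset.sum_congr rfl fun i hi => (coe_trunc_of_le (hle hi).le).symm
  have hlt : ∀ t ∈ (Finset.powersetCard (Fintype.card ι - A.card) Finset.univ).erase Aᶜ,
      ((∑ i ∈ Aᶜ, trunc c (v (a i)) : ℝ) : WithTop ℝ) < v (∏ i ∈ t, -a i) := by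
    intro t ht
    rw [Finset.mem_erase, Finset.mem_powersetCard, ← Finset.card_compl] at ht
    refine lt_of_lt_of_le ?_ (sum_trunc_le_map_prod v a c t)
    rw [WithTop.coe_lt_coe, ← Finset.sum_inter_add_sum_sdiff Aᶜ t,
      ← Finset.sum_inter_add_sum_sdiff t Aᶜ, Finset.inter_comm t]
    have hcard : (Aᶜ \ t).card = (t \ Aᶜ).card := by
      have h1 := Finset.card_sdiff_add_card_inter Aᶜ t
      have h2 := Finset.card_sdiff_add_card_inter t Aᶜ
      rw [Finset.inter_comm] at h2
      omega
    have hne : (Aᶜ \ t).Nonempty := by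
      rw [Finset.sdiff_nonempty]
      intro hsub
      exact ht.1 (Finset.eq_of_subset_of_card_le hsub ht.2.2.le).symm
    have h1 : ∑ i ∈ t \ Aᶜ, trunc c (v (a i)) = (t \ Aᶜ).card * c := by
      rw [Finset.sum_congr rfl (g := fun _ => c)]
      · simp
      · intro i hi
        rw [Finset.mem_sdiff, Finset.mem_compl, not_not] at hi
        exact trunc_of_le (Finset.mem_filter.mp hi.2).2.le
    have h2 : ∑ i ∈ Aᶜ \ t, trunc c (v (a i)) < (Aᶜ \ t).card * c := by
      have h3 : ∑ i ∈ Aᶜ \ t, trunc c (v (a i)) < ∑ i ∈ Aᶜ \ t, c := by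
        refine Finset.sum_lt_sum_of_nonempty hne fun i hi => ?_
        have h4 := hle (Finset.mem_sdiff.mp hi).1
        rwa [← coe_trunc_of_le h4.le, WithTop.coe_lt_coe] at h4
      simpa using h3
    rw [h1, ← hcard]
    linarith
  rw [← Finset.add_sum_erase _ _ hmem, hsum, ← hmain]
  rw [← hmain] at hlt
  refine AddValuation.map_add_eq_of_lt_left v ?_
  exact AddValuation.map_lt_sum v (by rw [hmain]; exact WithTop.coe_ne_top) hlt

/-- Since x may be a weight, it is moved slightly up; `coeff_countGE_le` moves it down. Together
they give the two ends of the edge of slope -x. -/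
lemma coeff_countGT_le (x : ℝ) :
    v ((∏ i, (X - C (a i))).coeff (countGT (fun i => v (a i)) x)) ≤
      ((truncSum (fun i => v (a i)) x - countGT (fun i => v (a i)) x * x : ℝ) : WithTop ℝ) := by
  obtain ⟨c, hc, hgap⟩ := exists_gap_above (fun i => v (a i)) x
  obtain ⟨-, h2, h3⟩ := hgap c hc le_rfl
  have h := coeff_countGT_eq v a h3
  rw [h2] at h
  rw [h, WithTop.coe_le_coe]
  have := truncSum_sub_le (w := fun i => v (a i)) hc.le
  linarith

lemma coeff_countGE_le (x : ℝ) :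
    v ((∏ i, (X - C (a i))).coeff (countGE (fun i => v (a i)) x)) ≤
      ((truncSum (fun i => v (a i)) x - countGE (fun i => v (a i)) x * x : ℝ) : WithTop ℝ) := by
  obtain ⟨c, hc, hgap⟩ := exists_gap_below (fun i => v (a i)) x
  obtain ⟨h2, h3⟩ := hgap c le_rfl hc
  have h := coeff_countGT_eq v a h3
  rw [h2] at h
  rw [h, WithTop.coe_le_coe]
  have := le_truncSum_sub (w := fun i => v (a i)) hc.le
  linarith

end Product

end SlopeData

/-! ### Embeddings of L, ramification indices and the Hasse–Herbrand function. -/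

section Embeddings

variable {K : Type*} [Field K] [ValuativeRel K] [TopologicalSpace K] [IsNonarchimedeanLocalField K]
variable {L : Type*} [Field L] [Algebra K L]

instance isAlgebraic_separableClosure [Algebra.IsAlgebraic K L] :
    Algebra.IsAlgebraic K (SeparableClosure L) := Algebra.IsAlgebraic.trans K L _

lemma algHom_injective_apply [FiniteDimensional K L] {π : L}
    (hL : IntermediateField.adjoin K {π} = ⊤) {M : Type*} [Field M] [Algebra K M] :
    Function.Injective fun σ : L →ₐ[K] M => σ π := by
  intro σ τ h
  ext x
  obtain ⟨q, rfl⟩ := exists_aeval_eq_of_adjoin_eq_top hL x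
  simp only at h
  rw [← aeval_algHom_apply, ← aeval_algHom_apply, h]

lemma card_algHom_separableClosure [FiniteDimensional K L] [Algebra.IsSeparable K L] :
    Fintype.card (L →ₐ[K] SeparableClosure L) = Module.finrank K L := by
  rw [← Nat.card_eq_fintype_card]
  exact AlgHom.natCard_of_splits K L _ fun x =>
    IsSepClosed.splits_codomain _ (Algebra.IsSeparable.isSeparable K x)

lemma map_minpoly_eq_prod [FiniteDimensional K L] [Algebra.IsSeparable K L] {π : L}
    (hL : IntermediateField.adjoin K {π} = ⊤) :
    (minpoly K π).map (algebraMap K (SeparableClosure L)) =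
      ∏ σ : L →ₐ[K] SeparableClosure L, (X - C (σ π)) := by
  have hint : IsIntegral K π := Algebra.IsIntegral.isIntegral π
  refine (eq_of_monic_of_dvd_of_natDegree_le (monic_prod_of_monic _ _ fun σ _ => monic_X_sub_C _)
    ((minpoly.monic hint).map _) ?_ ?_)
  · refine Finset.prod_dvd_of_coprime ?_ ?_
    · intro σ _ τ _ hne
      exact pairwise_coprime_X_sub_C (algHom_injective_apply hL) hne
    · intro σ _
      rw [dvd_iff_isRoot, IsRoot, eval_map_algebraMap, aeval_algHom_apply, minpoly.aeval, map_zero]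
  · rw [natDegree_prod_of_monic _ _ fun σ _ => monic_X_sub_C _, (minpoly.monic hint).natDegree_map,
      ← IntermediateField.adjoin.finrank hint, hL, IntermediateField.finrank_top']
    simp [card_algHom_separableClosure]

/-- The valuation of `σ(π) / π - 1`. -/
def weight (π : L) (σ : L →ₐ[K] SeparableClosure L) : WithTop ℝ :=
  extValue K L (σ π / algebraMap L (SeparableClosure L) π - 1)

section

variable [FiniteDimensional K L] {π : L}

lemma extValue_algebraMap_tower (x : L) :
    extValue K L (algebraMap L (SeparableClosure L) x) = extValue K L x :=
  extValue_map (IsScalarTower.toAlgHom K L (SeparableClosure L)) x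

lemma extValue_ne_top {M : Type*} [Field M] [Algebra K M] {x : M} (hx : x ≠ 0) :
    extValue K L x ≠ ⊤ := by
  unfold extValue
  rw [if_neg hx]
  exact WithTop.coe_ne_top

lemma ne_zero_of_extValue_eq_one (hπ : extValue K L π = ((1 : ℝ) : WithTop ℝ)) : π ≠ 0 := by
  rintro rfl; simp [extValue] at hπ

lemma extValue_conj_div (hπ : π ≠ 0) (σ : L →ₐ[K] SeparableClosure L) :
    extValue K L (σ π / algebraMap L (SeparableClosure L) π) = 0 := by
  have h0 : algebraMap L (SeparableClosure L) π ≠ 0 := by simpa using hπ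
  have h1 := AddValuation.map_mul (extValuation K L (SeparableClosure L))
    (σ π / algebraMap L (SeparableClosure L) π) (algebraMap L (SeparableClosure L) π)
  rw [div_mul_cancel₀ _ h0] at h1
  simp only [extValuation_apply] at h1
  rw [extValue_map, extValue_algebraMap_tower] at h1
  lift extValue K L π to ℝ using extValue_ne_top hπ with r hr
  lift extValue K L (σ π / algebraMap L (SeparableClosure L) π) to ℝ using
    extValue_ne_top (div_ne_zero (by simpa using hπ) h0) with s hs
  rw [← WithTop.coe_add, WithTop.coe_inj] at h1
  rw [← WithTop.coe_zero, WithTop.coe_inj]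
  linarith

lemma weight_nonneg (hπ : π ≠ 0) (σ : L →ₐ[K] SeparableClosure L) : 0 ≤ weight π σ :=
  AddValuation.map_le_sub (extValuation K L (SeparableClosure L))
    (extValue_conj_div hπ σ).ge (AddValuation.map_one _).ge

/-- An infinite weight means that σ fixes π, which determines σ on L = K(π). -/
lemma ncard_weight_eq_top_le (hL : IntermediateField.adjoin K {π} = ⊤) (hπ : π ≠ 0) :
    {σ : L →ₐ[K] SeparableClosure L | weight π σ = ⊤}.ncard ≤ 1 := by
  have h0 : algebraMap L (SeparableClosure L) π ≠ 0 := by simpa using hπ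
  have h (σ : L →ₐ[K] SeparableClosure L) (hσ : weight π σ = ⊤) :
      σ π = algebraMap L (SeparableClosure L) π := by
    have h1 := (AddValuation.top_iff (extValuation K L (SeparableClosure L))).mp hσ
    rw [sub_eq_zero, div_eq_one_iff_eq h0] at h1
    exact h1
  rw [Set.ncard_le_one_iff_eq]
  rcases Set.eq_empty_or_nonempty {σ : L →ₐ[K] SeparableClosure L | weight π σ = ⊤} with he | ⟨τ, hτ⟩
  · exact Or.inl he
  · refine Or.inr ⟨τ, Set.eq_singleton_iff_unique_mem.mpr ⟨hτ, fun σ hσ => ?_⟩⟩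
    exact algHom_injective_apply hL ((h σ hσ).trans (h τ hτ).symm)

/-- Expand x in powers of π: every term has valuation at least that of x, and σ multiplies the i-th
term by y^i, where y = σ(π)/π is a unit, so that y - 1 divides y^i - 1 integrally. -/
lemma weight_le_extValue (hL : IntermediateField.adjoin K {π} = ⊤)
    (hπ : extValue K L π = ((1 : ℝ) : WithTop ℝ)) (σ : L →ₐ[K] SeparableClosure L) {x : L}
    (hx : x ≠ 0) :
    weight π σ ≤ extValue K L (σ x / algebraMap L (SeparableClosure L) x - 1) := by
  have hπ0 := ne_zero_of_extValue_eq_one hπ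
  set ι := algebraMap L (SeparableClosure L)
  set v := extValuation K L (SeparableClosure L)
  have h0 : ι π ≠ 0 := by simpa [ι] using hπ0
  have hx0 : ι x ≠ 0 := by simpa [ι] using hx
  obtain ⟨r, hr, hrx⟩ := exists_expansion hL x
  set y := σ π / ι π with hy
  have hvy : v y = 0 := extValue_conj_div hπ0 σ
  have hpow (i : ℕ) : weight π σ ≤ v (y ^ i - 1) := by
    rw [← geom_sum_mul, AddValuation.map_mul]
    refine le_add_of_nonneg_of_le (AddValuation.map_le_sum v fun j _ => ?_) le_rfl
    rw [AddValuation.map_pow, hvy, smul_zero]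
  have hsum : x = ∑ i ∈ Finset.range (Module.finrank K L), algebraMap K L (r.coeff i) * π ^ i := by
    rw [← hrx, aeval_eq_sum_range' hr]
    simp_rw [Algebra.smul_def]
  have hdiff : σ x - ι x = ∑ i ∈ Finset.range (Module.finrank K L),
      ι (algebraMap K L (r.coeff i) * π ^ i) * (y ^ i - 1) := by
    conv_lhs => rw [hsum]
    rw [map_sum, map_sum, ← Finset.sum_sub_distrib]
    refine Finset.sum_congr rfl fun i _ => ?_
    rw [map_mul, map_mul, map_pow, map_pow, AlgHom.commutes, ← IsScalarTower.algebraMap_apply,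
      hy, div_pow]
    field_simp
  have hle : v (ι x) + weight π σ ≤ v (σ x - ι x) := by
    rw [hdiff]
    refine AddValuation.map_le_sum v fun i hi => ?_
    rw [AddValuation.map_mul]
    refine add_le_add ?_ (hpow i)
    have h1 := extValuation_sum_le hπ r.coeff (Finset.mem_range.mp hi)
    rw [← hsum, extValuation_apply, extValuation_apply] at h1
    change extValue K L (ι x) ≤ extValue K L (ι _)
    rwa [extValue_algebraMap_tower, extValue_algebraMap_tower]
  have hz : σ x - ι x = ι x * (σ x / ι x - 1) := by field_simp
  rw [hz, AddValuation.map_mul] at hle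
  change weight π σ ≤ v _
  have hvx : v (ι x) ≠ ⊤ := (AddValuation.ne_top_iff v).mpr hx0
  exact (WithTop.add_le_add_iff_left hvx).mp hle

lemma ramIndex_eq_weight (hL : IntermediateField.adjoin K {π} = ⊤)
    (hπ : extValue K L π = ((1 : ℝ) : WithTop ℝ)) (σ : L →ₐ[K] SeparableClosure L) :
    ramIndex K L σ = (WithBot.some (weight π σ) : EReal) := by
  have hπ0 := ne_zero_of_extValue_eq_one hπ
  apply le_antisymm
  · have h0 : (0 : EReal) ≤ vExt K L π := by
      rw [← EReal.coe_zero, coe_le_vExt_iff, hπ, WithTop.coe_le_coe]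
      exact zero_le_one
    refine (iInf_le _ ⟨π, hπ0, h0⟩).trans ?_
    rw [vExt_eq_extValue]
    rfl
  · refine le_iInf fun x => ?_
    rw [vExt_eq_extValue]
    exact WithBot.coe_le_coe.mpr (weight_le_extValue hL hπ σ x.2.1)

lemma integral_indicator_weight {x : ℝ} (hx : 0 ≤ x) {a : WithTop ℝ} (ha : 0 ≤ a) :
    ∫ t in (0 : ℝ)..x, {t : ℝ | (t : WithTop ℝ) ≤ a}.indicator (fun _ => (1 : ℝ)) t = trunc x a := by
  cases a with
  | top => simp [trunc_top]
  | coe a =>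
    have ha' : 0 ≤ a := by exact_mod_cast ha
    simp only [WithTop.coe_le_coe]
    rw [trunc_coe]
    rcases le_total x a with h | h
    · rw [min_eq_left h, intervalIntegral.integral_congr (g := fun _ => (1 : ℝ))]
      · simp
      · intro t ht
        rw [Set.uIcc_of_le hx] at ht
        exact Set.indicator_of_mem (s := {t : ℝ | t ≤ a}) (ht.2.trans h) _
    · rw [min_eq_right h, intervalIntegral.integral_indicator ⟨ha', h⟩]
      simp

/-- The size of Γ_t is the sum over σ of the indicator of t ≤ w_σ, and each indicator integrates
over [0, x] to min(x, w_σ). -/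
lemma finrank_mul_hasseHerbrand (hL : IntermediateField.adjoin K {π} = ⊤)
    (hπ : extValue K L π = ((1 : ℝ) : WithTop ℝ)) {x : ℝ} (hx : 0 ≤ x) :
    (Module.finrank K L : ℝ) * hasseHerbrand K L x =
      truncSum (weight (K := K) π) x := by
  classical
  have hd : (Module.finrank K L : ℝ) ≠ 0 := by exact_mod_cast Module.finrank_pos.ne'
  have hcount (t : ℝ) : ((ramSet K L t).ncard : ℝ) = ∑ σ : L →ₐ[K] SeparableClosure L,
      {t : ℝ | (t : WithTop ℝ) ≤ weight π σ}.indicator (fun _ => (1 : ℝ)) t := by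
    have h1 : ramSet K L t = ((Finset.univ.filter fun σ : L →ₐ[K] SeparableClosure L =>
        (t : WithTop ℝ) ≤ weight π σ : Finset _) : Set (L →ₐ[K] SeparableClosure L)) := by
      ext σ
      simp only [ramSet, Set.mem_ofPred_eq, Finset.coe_filter, Finset.mem_univ, true_and]
      rw [ramIndex_eq_weight hL hπ]
      exact WithBot.coe_le_coe
    rw [h1, Set.ncard_coe_finset, Finset.card_filter, Nat.cast_sum]
    refine Finset.sum_congr rfl fun σ _ => ?_
    by_cases h : (t : WithTop ℝ) ≤ weight π σ
    · rw [if_pos h, Set.indicator_of_mem (s := {t : ℝ | (t : WithTop ℝ) ≤ weight π σ}) h]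
      simp
    · rw [if_neg h, Set.indicator_of_notMem (s := {t : ℝ | (t : WithTop ℝ) ≤ weight π σ}) h]
      simp
  rw [hasseHerbrand, ← mul_assoc, mul_one_div, div_self hd, one_mul]
  simp_rw [hcount]
  rw [intervalIntegral.integral_finsetSum]
  · exact Finset.sum_congr rfl fun σ _ =>
      integral_indicator_weight hx (weight_nonneg (ne_zero_of_extValue_eq_one hπ) σ)
  · intro σ _
    apply Antitone.intervalIntegrable
    intro s t hst
    by_cases h : (t : WithTop ℝ) ≤ weight π σ
    · rw [Set.indicator_of_mem (s := {t : ℝ | (t : WithTop ℝ) ≤ weight π σ}) h,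
        Set.indicator_of_mem (s := {t : ℝ | (t : WithTop ℝ) ≤ weight π σ})
          (le_trans (by exact_mod_cast hst) h)]
    · rw [Set.indicator_of_notMem (s := {t : ℝ | (t : WithTop ℝ) ≤ weight π σ}) h]
      exact Set.indicator_nonneg (fun _ _ => zero_le_one) _

lemma tau_eq_slopeBreak (hL : IntermediateField.adjoin K {π} = ⊤)
    (hπ : extValue K L π = ((1 : ℝ) : WithTop ℝ)) (p ℓ : ℕ) :
    tau K L p ℓ = slopeBreak (weight (K := K) π) ((p : ℝ) ^ ℓ) := by
  unfold tau slopeBreak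
  congr 1
  ext t
  refine and_congr_right fun ht => forall₂_congr fun x y => forall₂_congr fun hx hy => ?_
  rw [finrank_mul_hasseHerbrand hL hπ (ht.trans hx),
    finrank_mul_hasseHerbrand hL hπ (ht.trans (hx.trans hy))]

lemma xi_eq_slopeIntercept (hL : IntermediateField.adjoin K {π} = ⊤)
    (hπ : extValue K L π = ((1 : ℝ) : WithTop ℝ)) (p ℓ : ℕ) :
    xi K L p ℓ = slopeIntercept (weight (K := K) π) ((p : ℝ) ^ ℓ) := by
  rw [xi, tau_eq_slopeBreak hL hπ, slopeIntercept,
    finrank_mul_hasseHerbrand hL hπ (slopeBreak_nonneg _)]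

/-- The polynomial `f(π + πT)`, for the minimal polynomial `f` of `π`, is up to a constant factor
the product of the `T - (σ(π) / π - 1)`. -/
lemma extValue_coeff_comp [Algebra.IsSeparable K L] {f : 𝒪[K][X]} (hf : f.Monic)
    (hE : f.IsEisensteinAt 𝓂[K]) (hfπ : aeval π f = 0)
    (hL : IntermediateField.adjoin K {π} = ⊤) (k : ℕ) :
    extValue K L (((f.map (algebraMap 𝒪[K] L)).comp (C π + C π * X)).coeff k) =
      ((Module.finrank K L : ℝ) : WithTop ℝ) + extValuation K L (SeparableClosure L)
        ((∏ σ : L →ₐ[K] SeparableClosure L,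
          (X - C (σ π / algebraMap L (SeparableClosure L) π - 1))).coeff k) := by
  have hn := finrank_eq_natDegree hf hE hfπ hL
  have hπ := extValue_root hf hE hfπ hn
  have hπ0 := ne_zero_of_extValue_eq_one hπ
  set ι := algebraMap L (SeparableClosure L)
  have h0 : ι π ≠ 0 := by simpa [ι] using hπ0
  have hfac : ((f.map (algebraMap 𝒪[K] L)).comp (C π + C π * X)).map ι =
      C (ι π ^ Module.finrank K L) * ∏ σ : L →ₐ[K] SeparableClosure L,
        (X - C (σ π / ι π - 1)) := by
    have h1 : (f.map (algebraMap 𝒪[K] L)).map ι = ∏ σ : L →ₐ[K] SeparableClosure L,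
        (X - C (σ π)) := by
      rw [← map_minpoly_eq_prod hL, ← map_eq_minpoly hf hE hfπ, Polynomial.map_map,
        Polynomial.map_map]
      rfl
    rw [Polynomial.map_comp, h1, prod_comp, ← card_algHom_separableClosure (K := K) (L := L),
      C_pow, ← Finset.card_univ, ← Finset.prod_const, ← Finset.prod_mul_distrib]
    refine Finset.prod_congr rfl fun σ _ => ?_
    simp only [Polynomial.map_add, Polynomial.map_mul, map_C, map_X, sub_comp, X_comp, C_comp]
    rw [mul_sub, ← C_mul]
    have h2 : ι π * (σ π / ι π - 1) = σ π - ι π := by field_simp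
    rw [h2, C_sub]
    ring
  rw [← extValue_algebraMap_tower, ← coeff_map, hfac, coeff_C_mul,
    ← extValuation_apply, AddValuation.map_mul]
  congr 1
  rw [← map_pow, extValuation_apply, extValue_algebraMap_tower, ← extValuation_apply,
    valuation_eq_of_extValue_eq_one hπ]

end

end Embeddings

/-! ### Binomial coefficients and bounds on the coefficients of Eisenstein polynomials. -/

section CoefficientBounds

section Binomial

variable {p : ℕ} [hp : Fact p.Prime]

/-- By Lucas: the b lowest base-p digits of both i - 1 and p^b - 1 are all equal to p - 1. -/
lemma not_dvd_choose_pred {b : ℕ} : ∀ {i : ℕ}, 0 < i → p ^ b ∣ i →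
    ¬ p ∣ (i - 1).choose (p ^ b - 1) := by
  induction b with
  | zero => intro i _ _; simpa using hp.out.one_lt.ne'
  | succ b ih =>
    rintro i hi ⟨u, rfl⟩
    have hp1 := hp.out.one_lt
    have hu : 0 < u := Nat.pos_of_mul_pos_left hi
    have hq : ∀ t : ℕ, 0 < t → (p * t - 1) % p = p - 1 ∧ (p * t - 1) / p = t - 1 := by
      intro t ht
      obtain ⟨t, rfl⟩ := Nat.exists_eq_succ_of_ne_zero ht.ne'
      have h1 : p * (t + 1) - 1 = (p - 1) + p * t := by rw [mul_add, mul_one]; omega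
      rw [Nat.succ_eq_add_one, h1, Nat.add_mul_mod_self_left, Nat.mod_eq_of_lt (by omega),
        Nat.add_mul_div_left _ _ (by omega), Nat.div_eq_of_lt (by omega)]
      simp
    have h1 := Choose.choose_modEq_choose_mod_mul_choose_div_nat
      (n := p ^ (b + 1) * u - 1) (k := p ^ (b + 1) - 1) (p := p)
    have e1 : p ^ (b + 1) * u = p * (p ^ b * u) := by ring
    have e2 : p ^ (b + 1) = p * p ^ b := by ring
    rw [e1, e2, (hq _ (by positivity)).1, (hq _ (by positivity)).2, (hq (p ^ b) (by positivity)).1,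
      (hq (p ^ b) (by positivity)).2, Nat.choose_self, one_mul] at h1
    rw [e1, e2, (h1.dvd_iff dvd_rfl)]
    exact ih (by positivity) (Dvd.intro _ rfl)

lemma padicValNat_choose_prime_pow {i b : ℕ} (hi : 0 < i) (hb : p ^ b ∣ i) :
    padicValNat p (i.choose (p ^ b)) + b = padicValNat p i := by
  have hpb : 0 < p ^ b := pow_pos hp.out.pos _
  have hle : p ^ b ≤ i := Nat.le_of_dvd hi hb
  have h1 : i * (i - 1).choose (p ^ b - 1) = i.choose (p ^ b) * p ^ b := by
    have := Nat.add_one_mul_choose_eq (i - 1) (p ^ b - 1)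
    rwa [Nat.sub_add_cancel hi, Nat.sub_add_cancel hpb] at this
  have h2 := congrArg (padicValNat p) h1
  rw [padicValNat.mul hi.ne' (Nat.choose_pos (by omega)).ne',
    padicValNat.mul (Nat.choose_pos hle).ne' hpb.ne', padicValNat.prime_pow,
    padicValNat.eq_zero_of_not_dvd (not_dvd_choose_pred hi hb)] at h2
  omega

lemma padicValNat_le_choose_add {i k : ℕ} (hk : 0 < k) (hki : k ≤ i) :
    padicValNat p i ≤ padicValNat p (i.choose k) + padicValNat p k := by
  have hi : 0 < i := by omega
  have h1 : i * (i - 1).choose (k - 1) = i.choose k * k := by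
    have := Nat.add_one_mul_choose_eq (i - 1) (k - 1)
    rwa [Nat.sub_add_cancel hi, Nat.sub_add_cancel hk] at this
  have h2 := congrArg (padicValNat p) h1
  rw [padicValNat.mul hi.ne' (Nat.choose_pos (by omega)).ne',
    padicValNat.mul (Nat.choose_pos hki).ne' hk.ne'] at h2
  omega

/-- From binom(i,k) binom(k,q) = binom(i,q) binom(i-q,k-q) with q = p^b, where binom(k,q) has p-adic
valuation v_p(k) - b. -/
lemma padicValNat_choose_prime_pow_le {i k b : ℕ} (hk : 0 < k) (hki : k ≤ i) (hb : p ^ b ∣ k) :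
    padicValNat p (i.choose (p ^ b)) + b ≤ padicValNat p (i.choose k) + padicValNat p k := by
  have hle : p ^ b ≤ k := Nat.le_of_dvd hk hb
  have h1 := congrArg (padicValNat p) (Nat.choose_mul (n := i) hle)
  rw [padicValNat.mul (Nat.choose_pos hki).ne' (Nat.choose_pos hle).ne',
    padicValNat.mul (Nat.choose_pos (by omega)).ne' (Nat.choose_pos (by omega)).ne'] at h1
  have h2 := padicValNat_choose_prime_pow hk hb
  omega

end Binomial

variable {K : Type*} [Field K] [ValuativeRel K] [TopologicalSpace K] [IsNonarchimedeanLocalField K]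
variable {L : Type*} [Field L] [Algebra K L]

section NatCast

variable (p : ℕ) [hp : Fact p.Prime] [CharP 𝓀[K] p] [FiniteDimensional K L]

lemma extValue_natCast_of_not_dvd {M : Type*} [Field M] [Algebra K M] {N : ℕ} (hN : ¬ p ∣ N) :
    extValue K L (N : M) = 0 := by
  have hres : IsLocalRing.residue 𝒪[K] (N : 𝒪[K]) ≠ 0 := by
    rw [map_natCast]
    exact fun h => hN ((CharP.cast_eq_zero_iff 𝓀[K] p N).mp h)
  have hu : IsUnit (N : 𝒪[K]) := (IsLocalRing.residue_ne_zero_iff_isUnit _).mp hres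
  have h0 : (N : 𝒪[K]) ≠ 0 := hu.ne_zero
  have h1 := extValue_algebraMap_integer (L := L) (M := M) h0
  rw [(isUnit_iff_vBase_eq_zero h0).mp hu, map_natCast] at h1
  simpa using h1

/-- In characteristic p the value of p is `⊤`; the formula survives because `0 • ⊤ = 0`. -/
lemma extValue_natCast {N : ℕ} (hN : N ≠ 0) :
    extValue K L (N : L) = padicValNat p N • extValue K L (p : L) := by
  obtain ⟨u, hu⟩ := pow_padicValNat_dvd (p := p) (n := N)
  have h1 : ¬ p ∣ u := by
    rintro ⟨t, ht⟩
    rw [ht, ← mul_assoc, ← pow_succ] at hu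
    exact pow_succ_padicValNat_not_dvd hN (p := p) ⟨t, hu⟩
  have h2 : (N : L) = (p : L) ^ padicValNat p N * u := by
    conv_lhs => rw [hu]
    push_cast; rfl
  rw [h2, ← extValuation_apply, AddValuation.map_mul, AddValuation.map_pow, extValuation_apply,
    extValuation_apply, extValue_natCast_of_not_dvd p h1, add_zero]

lemma extValue_natCast_nonneg (N : ℕ) : 0 ≤ extValue K L (N : L) := by
  have := extValue_algebraMap_integer_nonneg (L := L) (M := L) (N : 𝒪[K])
  rwa [map_natCast] at this

end NatCast

section Coefficients

lemma coeff_comp_C_add_C_mul_X {R : Type*} [CommRing R] (h : R[X]) (x : R) {N : ℕ}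
    (hN : h.natDegree < N) (k : ℕ) :
    (h.comp (C x + C x * X)).coeff k =
      ∑ i ∈ Finset.range N, h.coeff i * (i.choose k : R) * x ^ i := by
  have h1 : (C x + C x * X : R[X]) = C x * (1 + X) := by ring
  rw [comp_eq_sum_left, h.sum_over_range' (by simp) N hN, finsetSum_coeff]
  refine Finset.sum_congr rfl fun i _ => ?_
  rw [h1, mul_pow, ← C_pow, coeff_C_mul, coeff_C_mul, coeff_one_add_X_pow]
  ring

lemma coeff_comp_C_add_C_pow_mul_X {R : Type*} [CommRing R] (h : R[X]) (x : R) (m k : ℕ) :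
    (h.comp (C x + C (x ^ (m + 1)) * X)).coeff k =
      (h.comp (C x + C x * X)).coeff k * x ^ (m * k) := by
  have h1 : h.comp (C x + C (x ^ (m + 1)) * X) =
      (h.comp (C x + C x * X)).comp (C (x ^ m) * X) := by
    rw [comp_assoc]
    congr 1
    simp only [add_comp, mul_comp, C_comp, X_comp]
    rw [← mul_assoc, ← C_mul, pow_succ']
  rw [h1, comp_C_mul_X_coeff, pow_mul]

variable [FiniteDimensional K L] [Algebra.IsSeparable K L] {f : 𝒪[K][X]} {π : L}

/-- For k > 0 the term of index 0 vanishes. After division by π the exponents run over 0, …, n - 1,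
so the terms have distinct valuations and none lies below their sum. -/
lemma extValue_coeff_comp_le (hf : f.Monic) (hE : f.IsEisensteinAt 𝓂[K]) (hfπ : aeval π f = 0)
    (hL : IntermediateField.adjoin K {π} = ⊤) {k i : ℕ} (hk : 0 < k) (hi : 0 < i)
    (hin : i ≤ f.natDegree) :
    extValue K L (((f.map (algebraMap 𝒪[K] L)).comp (C π + C π * X)).coeff k) ≤
      extValue K L (algebraMap 𝒪[K] L (f.coeff i)) + extValue K L (i.choose k : L) +
        ((i : ℝ) : WithTop ℝ) := by
  have hn := finrank_eq_natDegree hf hE hfπ hL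
  have hπ := extValue_root hf hE hfπ hn
  have h1 := coeff_comp_C_add_C_mul_X (f.map (algebraMap 𝒪[K] L)) π
    (N := Module.finrank K L + 1) (by rw [hf.natDegree_map, hn]; omega) k
  rw [Finset.sum_range_succ', Nat.choose_eq_zero_of_lt hk] at h1
  obtain ⟨j, rfl⟩ := Nat.exists_eq_succ_of_ne_zero hi.ne'
  have h2 := extValuation_sum_le hπ (fun i => (f.coeff (i + 1) : K) * ((i + 1).choose k : K))
    (i := j) (by omega)
  have h3 : ((f.map (algebraMap 𝒪[K] L)).comp (C π + C π * X)).coeff k =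
      π * ∑ i ∈ Finset.range (Module.finrank K L),
        algebraMap K L ((f.coeff (i + 1) : K) * ((i + 1).choose k : K)) * π ^ i := by
    rw [h1, Finset.mul_sum]
    simp only [Nat.cast_zero, mul_zero, zero_mul, add_zero]
    refine Finset.sum_congr rfl fun i _ => ?_
    rw [coeff_map, map_mul, map_natCast]
    have h4 : algebraMap 𝒪[K] L (f.coeff (i + 1)) = algebraMap K L (f.coeff (i + 1)) := rfl
    rw [h4, pow_succ]
    ring
  have h4 := add_le_add_right h2 (extValuation K L L π)
  rw [h3, ← extValuation_apply, AddValuation.map_mul]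
  refine h4.trans (le_of_eq ?_)
  rw [AddValuation.map_mul, valuation_eq_of_extValue_eq_one hπ, map_mul, AddValuation.map_mul,
    map_natCast, extValuation_apply, hπ, extValuation_apply, extValuation_apply, add_comm,
    add_assoc, ← WithTop.coe_add]
  push_cast
  rfl

lemma le_extValue_coeff_comp (hf : f.Monic) (hE : f.IsEisensteinAt 𝓂[K]) (hfπ : aeval π f = 0)
    (hL : IntermediateField.adjoin K {π} = ⊤) (x : ℝ) (k : ℕ) :
    ((truncSum (weight (K := K) π) x - k * x + f.natDegree : ℝ) : WithTop ℝ) ≤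
      extValue K L (((f.map (algebraMap 𝒪[K] L)).comp (C π + C π * X)).coeff k) := by
  rw [extValue_coeff_comp hf hE hfπ hL, finrank_eq_natDegree hf hE hfπ hL, add_comm (_ - _),
    WithTop.coe_add]
  exact add_le_add_right (truncSum_sub_le_coeff (extValuation K L (SeparableClosure L)) _ x k) _

lemma natDegree_le_extValue_coeff (hf : f.Monic) (hE : f.IsEisensteinAt 𝓂[K])
    (hfπ : aeval π f = 0) (hL : IntermediateField.adjoin K {π} = ⊤) {i : ℕ}
    (hin : i ≤ f.natDegree) : ((f.natDegree : ℝ) : WithTop ℝ) ≤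
      extValue K L (algebraMap 𝒪[K] L (f.coeff i)) + ((i : ℝ) : WithTop ℝ) := by
  rcases hin.eq_or_lt with rfl | hlt
  · exact le_add_of_nonneg_left (extValue_algebraMap_integer_nonneg _)
  · have h1 := le_extValue_of_mem_maximalIdeal (L := L) (M := L) (hE.mem hlt)
    rw [finrank_eq_natDegree hf hE hfπ hL] at h1
    exact h1.trans (le_add_of_nonneg_right (by exact_mod_cast Nat.zero_le i))

variable (p : ℕ) [Fact p.Prime] [CharP 𝓀[K] p]

/-- The bounds that ramification imposes on the coefficients of an Eisenstein polynomial. -/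
lemma xi_add_le_coeff (hf : f.Monic) (hE : f.IsEisensteinAt 𝓂[K]) (hfπ : aeval π f = 0)
    (hL : IntermediateField.adjoin K {π} = ⊤) {i : ℕ} (hin : i ≤ f.natDegree) :
    ∃ a ≤ padicValNat p f.natDegree, p ^ a ∣ i ∧ ∀ b ≤ a,
      ((xi K L p b + f.natDegree : ℝ) : WithTop ℝ) ≤
        extValue K L (algebraMap 𝒪[K] L (f.coeff i)) + ((i : ℝ) : WithTop ℝ) +
          (a - b) • extValue K L (p : L) := by
  have hn := finrank_eq_natDegree hf hE hfπ hL
  have hπ := extValue_root hf hE hfπ hn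
  have hpos := natDegree_pos_of_aeval_eq_zero hf hfπ
  have key (i : ℕ) (hi : 0 < i) (hin : i ≤ f.natDegree) (b : ℕ) (hb : b ≤ padicValNat p i) :
      ((xi K L p b + f.natDegree : ℝ) : WithTop ℝ) ≤
        extValue K L (algebraMap 𝒪[K] L (f.coeff i)) + ((i : ℝ) : WithTop ℝ) +
          (padicValNat p i - b) • extValue K L (p : L) := by
    have hbi : p ^ b ∣ i := (pow_dvd_pow p hb).trans pow_padicValNat_dvd
    -- At abscissa p^b, the supporting line of slope -τ_b has height ξ_b + n.
    have h1 := (le_extValue_coeff_comp hf hE hfπ hL (slopeBreak (weight (K := K) π) ((p : ℝ) ^ b))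
      (p ^ b)).trans (extValue_coeff_comp_le hf hE hfπ hL (pow_pos (Fact.out : p.Prime).pos _) hi hin)
    have h2 := padicValNat_choose_prime_pow (p := p) hi hbi
    rw [extValue_natCast p (Nat.choose_pos (Nat.le_of_dvd hi hbi)).ne',
      show padicValNat p (i.choose (p ^ b)) = padicValNat p i - b by omega] at h1
    rw [xi_eq_slopeIntercept hL hπ, slopeIntercept, add_right_comm]
    push_cast at h1
    exact h1
  have hlead (b : ℕ) (hb : b ≤ padicValNat p f.natDegree) :
      ((xi K L p b + f.natDegree : ℝ) : WithTop ℝ) ≤ ((f.natDegree : ℝ) : WithTop ℝ) +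
          (padicValNat p f.natDegree - b) • extValue K L (p : L) := by
    have h1 := key f.natDegree hpos le_rfl b hb
    have h2 : extValue K L (algebraMap 𝒪[K] L (f.coeff f.natDegree)) = 0 := by
      rw [hf.coeff_natDegree, map_one, ← extValuation_apply, AddValuation.map_one]
    rwa [h2, zero_add] at h1
  have hbig := natDegree_le_extValue_coeff hf hE hfπ hL hin
  -- With s = v_p(n): if p^s ∣ i (which covers i = 0), take a = s and use the bound for the leading
  -- coefficient, since every term has valuation at least n. Otherwise take a = v_p(i) < s.
  by_cases hi : p ^ padicValNat p f.natDegree ∣ i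
  · exact ⟨_, le_rfl, hi, fun b hb => (hlead b hb).trans (add_le_add_left hbig _)⟩
  · have hi0 : 0 < i := Nat.pos_of_ne_zero (by rintro rfl; exact hi (dvd_zero _))
    refine ⟨padicValNat p i, ?_, pow_padicValNat_dvd, key i hi0 hin⟩
    by_contra h
    exact hi ((pow_dvd_pow p (by omega)).trans pow_padicValNat_dvd)

end Coefficients

end CoefficientBounds

/-! ### Filtrations of polynomials by p-divisibility of exponents and valuation. -/

section Levels

lemma coe_add_sub_le {x y : WithTop ℝ} {A B n i l : ℝ}
    (hA : (A : WithTop ℝ) ≤ x + (i : WithTop ℝ)) (hB : (B : WithTop ℝ) ≤ y + (l : WithTop ℝ)) :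
    ((A + B - n : ℝ) : WithTop ℝ) ≤ x + y + ((i - n + l : ℝ) : WithTop ℝ) := by
  cases x with
  | top => simp
  | coe x =>
    cases y with
    | top => simp
    | coe y =>
      norm_cast at *
      linarith

section Filtration

variable {O : Type*} [CommRing O] (μ : AddValuation O (WithTop ℝ)) (p : ℕ)

/-- The module generated by the terms `c X ^ i` with `p ^ j ∣ i` and `M j ≤ μ c + i` for
some `j ≤ s`. -/
def levelModule (s : ℕ) (M : ℕ → ℝ) : Submodule O O[X] :=
  Submodule.span O {h | ∃ (i : ℕ) (c : O), (∃ j ≤ s, p ^ j ∣ i ∧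
    (M j : WithTop ℝ) ≤ μ c + ((i : ℝ) : WithTop ℝ)) ∧ h = monomial i c}

/-- The module generated by the terms `p ^ (a - b) c X ^ i` with `p ^ b ∣ i` and
`p ^ b m ≤ μ c + i` for some `b ≤ a`. -/
def frobModule (m : ℝ) (a : ℕ) : Submodule O O[X] :=
  Submodule.span O {h | ∃ (b i : ℕ) (c : O), b ≤ a ∧ p ^ b ∣ i ∧
    ((p ^ b * m : ℝ) : WithTop ℝ) ≤ μ c + ((i : ℝ) : WithTop ℝ) ∧
    h = monomial i ((p : O) ^ (a - b) * c)}

variable {μ p} (hμ : ∀ c, 0 ≤ μ c) {m : ℝ} (hm : 0 ≤ m)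

include hμ

lemma monomial_mul_mem_frobModule {a b i j : ℕ} {c d : O} (hb : b ≤ a) (hi : p ^ b ∣ i)
    (hc : ((p ^ b * m : ℝ) : WithTop ℝ) ≤ μ c + ((i : ℝ) : WithTop ℝ)) (hj : p ^ b ∣ j) :
    monomial i ((p : O) ^ (a - b) * c) * monomial j d ∈ frobModule μ p m a := by
  rw [monomial_mul_monomial]
  refine Submodule.subset_span ⟨b, i + j, c * d, hb, dvd_add hi hj, hc.trans ?_, by rw [mul_assoc]⟩
  have h1 : μ (c * d) + (((i + j : ℕ) : ℝ) : WithTop ℝ) =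
      μ c + ((i : ℝ) : WithTop ℝ) + (μ d + ((j : ℝ) : WithTop ℝ)) := by
    rw [AddValuation.map_mul]
    push_cast
    exact add_add_add_comm _ _ _ _
  rw [h1]
  exact le_add_of_nonneg_right (add_nonneg (hμ d) (by exact_mod_cast Nat.zero_le j))

/-- A product of terms of levels b ≤ b' has level b: the second factor only increases the valuation.
-/
lemma mul_mem_frobModule {a : ℕ} {x y : O[X]} (hx : x ∈ frobModule μ p m a)
    (hy : y ∈ frobModule μ p m a) : x * y ∈ frobModule μ p m a := by
  induction hx using Submodule.span_induction with
  | zero => rw [zero_mul]; exact zero_mem _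
  | add x₁ x₂ _ _ h₁ h₂ => rw [add_mul]; exact add_mem h₁ h₂
  | smul r x _ h => rw [smul_mul_assoc]; exact Submodule.smul_mem _ _ h
  | mem x hx =>
    obtain ⟨b, i, c, hb, hi, hc, rfl⟩ := hx
    induction hy using Submodule.span_induction with
    | zero => rw [mul_zero]; exact zero_mem _
    | add x₁ x₂ _ _ h₁ h₂ => rw [mul_add]; exact add_mem h₁ h₂
    | smul r x _ h => rw [mul_smul_comm]; exact Submodule.smul_mem _ _ h
    | mem y hy =>
      obtain ⟨b', j, d, hb', hj, hd, rfl⟩ := hy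
      rcases le_total b b' with h | h
      · exact monomial_mul_mem_frobModule hμ hb hi hc ((pow_dvd_pow p h).trans hj)
      · rw [mul_comm]
        exact monomial_mul_mem_frobModule hμ hb' hj hd ((pow_dvd_pow p h).trans hi)

lemma mul_pow_mem_frobModule {a : ℕ} {x y : O[X]} (hx : x ∈ frobModule μ p m a)
    (hy : y ∈ frobModule μ p m a) (k : ℕ) : x * y ^ k ∈ frobModule μ p m a := by
  induction k with
  | zero => rwa [pow_zero, mul_one]
  | succ k ih => rw [pow_succ, ← mul_assoc]; exact mul_mem_frobModule hμ ih hy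

omit hμ in
lemma natCast_mul_mem_frobModule {a : ℕ} {x : O[X]} (hx : x ∈ frobModule μ p m a) (N : ℕ) :
    (N : O[X]) * x ∈ frobModule μ p m a := by
  rw [← nsmul_eq_mul]
  exact Submodule.smul_of_tower_mem _ N hx

omit hμ in
lemma prime_mul_mem_frobModule {a : ℕ} {x : O[X]} (hx : x ∈ frobModule μ p m a) :
    (p : O[X]) * x ∈ frobModule μ p m (a + 1) := by
  induction hx using Submodule.span_induction with
  | zero => rw [mul_zero]; exact zero_mem _
  | add x₁ x₂ _ _ h₁ h₂ => rw [mul_add]; exact add_mem h₁ h₂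
  | smul r x _ h => rw [mul_smul_comm]; exact Submodule.smul_mem _ _ h
  | mem y hy =>
    obtain ⟨b, i, c, hb, hi, hc, rfl⟩ := hy
    refine Submodule.subset_span ⟨b, i, c, by omega, hi, hc, ?_⟩
    rw [← map_natCast (C : O →+* O[X]), C_mul_monomial, ← mul_assoc, ← pow_succ',
      Nat.succ_sub hb]

include hm in
-- Cross terms of a p-th power gain a factor p, raising a with b fixed; the p-th power of a monomial
-- instead raises b to b + 1.
lemma pow_prime_mem_frobModule (hp : p.Prime) {a : ℕ} {x : O[X]} (hx : x ∈ frobModule μ p m a) :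
    x ^ p ∈ frobModule μ p m (a + 1) := by
  have hp1 := hp.one_lt
  induction hx using Submodule.span_induction with
  | zero => rw [zero_pow hp.ne_zero]; exact zero_mem _
  | add x y hx hy h₁ h₂ =>
    rw [add_pow_prime_eq hp]
    refine add_mem (add_mem h₁ h₂) ?_
    rw [mul_assoc (p : O[X]) x y, mul_assoc (p : O[X])]
    refine prime_mul_mem_frobModule ?_
    rw [Finset.mul_sum]
    refine Submodule.sum_mem _ fun k _ => ?_
    rw [mul_comm (x ^ (k - 1) * y ^ (p - k - 1)), mul_left_comm, ← mul_assoc (x * y)]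
    have h₃ := mul_pow_mem_frobModule hμ (mul_mem_frobModule hμ hx hy) hx (k - 1)
    exact natCast_mul_mem_frobModule (mul_pow_mem_frobModule hμ h₃ hy (p - k - 1)) _
  | smul r x _ h => rw [_root_.smul_pow]; exact Submodule.smul_mem _ _ h
  | mem y hy =>
    obtain ⟨b, i, c, hb, hi, hc, rfl⟩ := hy
    rw [monomial_pow, mul_pow, ← pow_mul]
    -- Only (a + 1) - (b + 1) factors p are kept outside; the surplus ones go into the coefficient.
    have he : (a - b) * p = (a + 1 - (b + 1)) + (a - b) * (p - 1) := by
      obtain ⟨t, rfl⟩ := Nat.exists_eq_add_of_lt hp1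
      rw [Nat.add_sub_add_right, Nat.add_sub_cancel]
      ring
    rw [he, pow_add, mul_assoc]
    refine Submodule.subset_span ⟨b + 1, i * p, _, by omega, ?_, ?_, rfl⟩
    · rw [pow_succ]; exact mul_dvd_mul_right hi p
    · rw [AddValuation.map_mul, AddValuation.map_pow]
      have h1 : ((p ^ (b + 1) * m : ℝ) : WithTop ℝ) ≤
          p • μ c + (((i * p : ℕ) : ℝ) : WithTop ℝ) := by
        have h2 := nsmul_le_nsmul_right hc p
        rw [smul_add, ← WithTop.coe_nsmul, ← WithTop.coe_nsmul] at h2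
        refine (le_of_eq ?_).trans (h2.trans (le_of_eq ?_))
        · congr 1; rw [nsmul_eq_mul]; ring
        · congr 2; rw [nsmul_eq_mul]; push_cast; ring
      refine h1.trans (add_le_add_left ?_ _)
      rw [← AddValuation.map_pow, ← AddValuation.map_pow]
      exact le_add_of_nonneg_left (hμ _)

include hm in
lemma one_add_pow_prime_pow_sub_one_mem (hp : p.Prime) {U : O[X]} (hU : U ∈ frobModule μ p m 0)
    (a : ℕ) : (1 + U) ^ p ^ a - 1 ∈ frobModule μ p m a := by
  induction a with
  | zero => simpa using hU
  | succ a ih =>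
    set Y := (1 + U) ^ p ^ a - 1 with hY
    have h1 : (1 + U) ^ p ^ (a + 1) - 1 = (Y + 1) ^ p - 1 := by
      rw [hY, sub_add_cancel, ← pow_mul, ← pow_succ]
    rw [h1, add_pow_prime_eq hp, one_pow, add_right_comm, add_sub_cancel_right]
    refine add_mem (pow_prime_mem_frobModule hμ hm hp ih) ?_
    rw [mul_one, mul_assoc]
    refine prime_mul_mem_frobModule ?_
    rw [Finset.mul_sum]
    refine Submodule.sum_mem _ fun k _ => ?_
    rw [one_pow, mul_one, ← mul_assoc, mul_comm _ (Nat.cast _)]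
    exact natCast_mul_mem_frobModule (mul_pow_mem_frobModule hμ ih ih _) _

include hm in
lemma one_add_pow_sub_one_mem (hp : p.Prime) {U : O[X]} (hU : U ∈ frobModule μ p m 0)
    {a i : ℕ} (hi : p ^ a ∣ i) : (1 + U) ^ i - 1 ∈ frobModule μ p m a := by
  obtain ⟨k, rfl⟩ := hi
  have hY := one_add_pow_prime_pow_sub_one_mem hμ hm hp hU a
  rw [pow_mul]
  induction k with
  | zero => simp
  | succ k ih =>
    set Z := (1 + U) ^ p ^ a
    have h1 : Z ^ (k + 1) - 1 = (Z ^ k - 1) * (Z - 1) + (Z ^ k - 1) + (Z - 1) := by ring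
    rw [h1]
    exact add_mem (add_mem (mul_mem_frobModule hμ ih hY) ih) hY

omit hμ in
lemma monomial_mul_mem_levelModule {s a i : ℕ} {M : ℕ → ℝ} {c : O} (has : a ≤ s) (hi : p ^ a ∣ i)
    (hc : ∀ b ≤ a, (M b : WithTop ℝ) ≤ μ c + ((i : ℝ) : WithTop ℝ) + (a - b) • μ (p : O) +
      ((p ^ b * m : ℝ) : WithTop ℝ)) {x : O[X]} (hx : x ∈ frobModule μ p m a) :
    monomial i c * x ∈ levelModule μ p s M := by
  induction hx using Submodule.span_induction with
  | zero => rw [mul_zero]; exact zero_mem _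
  | add x₁ x₂ _ _ h₁ h₂ => rw [mul_add]; exact add_mem h₁ h₂
  | smul r x _ h => rw [mul_smul_comm]; exact Submodule.smul_mem _ _ h
  | mem y hy =>
    obtain ⟨b, j, d, hb, hj, hd, rfl⟩ := hy
    rw [monomial_mul_monomial]
    refine Submodule.subset_span ⟨i + j, _, ⟨b, hb.trans has,
      dvd_add ((pow_dvd_pow p hb).trans hi) hj, (hc b hb).trans ?_⟩, rfl⟩
    refine (add_le_add_right hd _).trans (le_of_eq ?_)
    rw [AddValuation.map_mul, AddValuation.map_mul, AddValuation.map_pow]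
    push_cast
    abel

include hm in
/-- Taylor expansion of `f` at a multiplicative perturbation of the variable. -/
lemma comp_sub_mem_levelModule (hp : p.Prime) {s : ℕ} {M : ℕ → ℝ} {f U : O[X]}
    (hU : U ∈ frobModule μ p m 0)
    (hf : ∀ i ≤ f.natDegree, ∃ a ≤ s, p ^ a ∣ i ∧ ∀ b ≤ a, (M b : WithTop ℝ) ≤
      μ (f.coeff i) + ((i : ℝ) : WithTop ℝ) + (a - b) • μ (p : O) +
        ((p ^ b * m : ℝ) : WithTop ℝ)) :
    f.comp (X * (1 + U)) - f ∈ levelModule μ p s M := by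
  -- The substitution multiplies the i-th term of f by (1 + U)^i.
  have h1 : f.comp (X * (1 + U)) - f = ∑ i ∈ Finset.range (f.natDegree + 1),
      monomial i (f.coeff i) * ((1 + U) ^ i - 1) := by
    conv_lhs =>
      rw [comp_eq_sum_left, f.sum_over_range (by simp)]
      arg 2
      rw [f.as_sum_range]
    rw [← Finset.sum_sub_distrib]
    refine Finset.sum_congr rfl fun i _ => ?_
    rw [mul_pow, ← C_mul_X_pow_eq_monomial]
    ring
  rw [h1]
  refine Submodule.sum_mem _ fun i hi => ?_
  obtain ⟨a, has, hai, ha⟩ := hf i (Nat.lt_succ_iff.mp (Finset.mem_range.mp hi))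
  exact monomial_mul_mem_levelModule has hai ha (one_add_pow_sub_one_mem hμ hm hp hU hai)

include hm in
/-- The modules `levelModule` attached to an Eisenstein polynomial are stable under reduction. -/
lemma modByMonic_mem_levelModule (hp : p.Prime) {s : ℕ} {ξ : ℕ → ℝ} (hξ : ∀ j ≤ s, 0 ≤ ξ j)
    {g : O[X]} (hg : g.Monic)
    (hcoef : ∀ i ≤ g.natDegree, ∃ a ≤ s, p ^ a ∣ i ∧ ((ξ a + g.natDegree : ℝ) : WithTop ℝ) ≤
      μ (g.coeff i) + ((i : ℝ) : WithTop ℝ))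
    (hbig : ∀ i ≤ g.natDegree, ((g.natDegree : ℝ) : WithTop ℝ) ≤
      μ (g.coeff i) + ((i : ℝ) : WithTop ℝ))
    (hs : p ^ s ∣ g.natDegree) {x : O[X]}
    (hx : x ∈ levelModule μ p s fun j => ξ j + g.natDegree + p ^ j * m) :
    x %ₘ g ∈ levelModule μ p s fun j => ξ j + g.natDegree + p ^ j * m := by
  nontriviality O
  set P := levelModule μ p s fun j => ξ j + g.natDegree + p ^ j * m with hP
  have key (i : ℕ) : ∀ c : O, (∃ j ≤ s, p ^ j ∣ i ∧
      ((ξ j + g.natDegree + p ^ j * m : ℝ) : WithTop ℝ) ≤ μ c + ((i : ℝ) : WithTop ℝ)) →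
      monomial i c %ₘ g ∈ P := by
    induction i using Nat.strong_induction_on with
    | _ i ih =>
    rintro c ⟨j, hjs, hji, hj⟩
    by_cases hin : i < g.natDegree
    · rw [(modByMonic_eq_self_iff hg).mpr]
      · exact Submodule.subset_span ⟨i, c, ⟨j, hjs, hji, hj⟩, rfl⟩
      · refine (degree_monomial_le i c).trans_lt ?_
        rw [degree_eq_natDegree hg.ne_zero]
        exact_mod_cast hin
    rw [not_lt] at hin
    -- Subtracting c T^(i-n) g replaces the monomial by ones of smaller exponent.
    have h1 : monomial i c = monomial (i - g.natDegree) c * g - ∑ l ∈ Finset.range g.natDegree,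
        monomial (i - g.natDegree + l) (c * g.coeff l) := by
      have h2 : monomial (i - g.natDegree) c * g = ∑ l ∈ Finset.range (g.natDegree + 1),
          monomial (i - g.natDegree + l) (c * g.coeff l) := by
        conv_lhs =>
          arg 2
          rw [g.as_sum_range]
        rw [Finset.mul_sum]
        exact Finset.sum_congr rfl fun l _ => monomial_mul_monomial _ _ _ _
      rw [h2, Finset.sum_range_succ, add_sub_cancel_left, hg.coeff_natDegree, mul_one,
        Nat.sub_add_cancel hin]
    rw [h1, sub_modByMonic, mul_self_modByMonic hg, zero_sub]
    refine neg_mem ?_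
    have h3 : (∑ l ∈ Finset.range g.natDegree, monomial (i - g.natDegree + l) (c * g.coeff l)) %ₘ g
        = ∑ l ∈ Finset.range g.natDegree,
          (monomial (i - g.natDegree + l) (c * g.coeff l)) %ₘ g :=
      map_sum (modByMonicHom g) _ _
    rw [h3]
    refine Submodule.sum_mem _ fun l hl => ?_
    rw [Finset.mem_range] at hl
    refine ih _ (by omega) _ ?_
    obtain ⟨a, has, hal, ha⟩ := hcoef l hl.le
    have hcast : ((i - g.natDegree + l : ℕ) : ℝ) = (i : ℝ) - g.natDegree + l := by
      rw [Nat.cast_add, Nat.cast_sub hin]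
    rw [AddValuation.map_mul, hcast]
    -- If j ≤ a the level j is kept, as v_L(g_l) + l ≥ n. If a < j the level drops to a: ξ_a comes
    -- from g_l, and ξ_j ≥ 0 and p^j m ≥ p^a m give the rest.
    rcases le_or_gt j a with hja | hja
    · refine ⟨j, hjs, dvd_add (Nat.dvd_sub hji ((pow_dvd_pow p hjs).trans hs))
        ((pow_dvd_pow p hja).trans hal), le_trans ?_ (coe_add_sub_le hj (hbig l hl.le))⟩
      rw [WithTop.coe_le_coe]
      linarith
    · have hpa : p ^ a ∣ i := (pow_dvd_pow p hja.le).trans hji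
      refine ⟨a, has, dvd_add (Nat.dvd_sub hpa ((pow_dvd_pow p has).trans hs)) hal,
        le_trans ?_ (coe_add_sub_le hj ha)⟩
      rw [WithTop.coe_le_coe]
      have h4 : (p : ℝ) ^ a * m ≤ p ^ j * m :=
        mul_le_mul_of_nonneg_right (pow_le_pow_right₀ (by exact_mod_cast hp.one_lt.le) hja.le) hm
      have h5 := hξ j hjs
      linarith
  induction hx using Submodule.span_induction with
  | zero => rw [zero_modByMonic]; exact zero_mem _
  | add x₁ x₂ _ _ h₁ h₂ => rw [add_modByMonic]; exact add_mem h₁ h₂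
  | smul r x _ h => rw [smul_modByMonic]; exact Submodule.smul_mem _ _ h
  | mem y hy =>
    obtain ⟨i, c, hc, rfl⟩ := hy
    exact key i c hc

end Filtration

end Levels

/-! ### The congruence between f and g. -/

section Congruence

variable {K : Type*} [Field K] [ValuativeRel K] [TopologicalSpace K] [IsNonarchimedeanLocalField K]
variable {L : Type*} [Field L] [Algebra K L] [FiniteDimensional K L]

variable (K L) in
/-- The valuation of `L`, restricted to `𝒪[K]`. -/
def integerValuation : AddValuation 𝒪[K] (WithTop ℝ) :=
  (extValuation K L L).comap (algebraMap 𝒪[K] L)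

lemma integerValuation_apply (c : 𝒪[K]) :
    integerValuation K L c = extValue K L (algebraMap 𝒪[K] L c) := rfl

lemma integerValuation_nonneg (c : 𝒪[K]) : 0 ≤ integerValuation K L c :=
  extValue_algebraMap_integer_nonneg c

lemma coe_le_vExt_add_iff {c : 𝒪[K]} {r : ℝ} {i : ℕ} :
    (r : EReal) ≤ vExt K L (c : K) + (i : EReal) ↔
      (r : WithTop ℝ) ≤ integerValuation K L c + ((i : ℝ) : WithTop ℝ) := by
  have h1 : integerValuation K L c = extValue K L (c : K) :=
    extValue_map (Algebra.ofId K L) (c : K)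
  have h2 : vExt K L (c : K) + (i : EReal) =
      (WithBot.some (integerValuation K L c + ((i : ℝ) : WithTop ℝ)) : EReal) := by
    rw [vExt_eq_extValue, h1, WithBot.coe_add]
    rfl
  rw [h2]
  exact WithBot.coe_le_coe

lemma levelModule_le_iSup (p s : ℕ) (M : ℕ → ℝ) :
    levelModule (integerValuation K L) p s M ≤
      ⨆ j ∈ Finset.range (s + 1), monomialModule K L (p ^ j) (M j) := by
  refine Submodule.span_le.mpr ?_
  rintro _ ⟨i, c, ⟨j, hjs, hji, hj⟩, rfl⟩
  refine Submodule.mem_iSup_of_mem j (Submodule.mem_iSup_of_mem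
    (Finset.mem_range.mpr (Nat.lt_succ_iff.mpr hjs)) (Submodule.subset_span ?_))
  exact ⟨i, c, hji, coe_le_vExt_add_iff.mpr hj, rfl⟩

section

variable [Algebra.IsSeparable K L] {π : L}

lemma ncard_weight_eq_top_le_pow (hL : IntermediateField.adjoin K {π} = ⊤) (hπ : π ≠ 0) {p : ℕ}
    (hp : p.Prime) (j : ℕ) :
    ({σ : L →ₐ[K] SeparableClosure L | weight π σ = ⊤}.ncard : ℝ) ≤ (p : ℝ) ^ j :=
  le_trans (by exact_mod_cast ncard_weight_eq_top_le hL hπ)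
    (one_le_pow₀ (by exact_mod_cast hp.one_lt.le))

lemma pow_le_card_algHom {p j : ℕ} (hj : j ≤ padicValNat p (Module.finrank K L)) :
    (p : ℝ) ^ j ≤ Fintype.card (L →ₐ[K] SeparableClosure L) := by
  rw [card_algHom_separableClosure]
  exact_mod_cast Nat.le_of_dvd Module.finrank_pos ((pow_dvd_pow p hj).trans pow_padicValNat_dvd)

lemma xi_nonneg (hL : IntermediateField.adjoin K {π} = ⊤)
    (hπ : extValue K L π = ((1 : ℝ) : WithTop ℝ)) {p : ℕ} (hp : p.Prime) {j : ℕ}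
    (hj : j ≤ padicValNat p (Module.finrank K L)) : 0 ≤ xi K L p j := by
  have hπ0 := ne_zero_of_extValue_eq_one hπ
  rw [xi_eq_slopeIntercept hL hπ]
  exact slopeIntercept_nonneg (weight_nonneg hπ0) (pow_le_card_algHom hj)
    (ncard_weight_eq_top_le_pow hL hπ0 hp j)

end

/-- The multiplicative perturbation relating two close uniformizers. -/
lemma exists_eq_mul_one_add {π ρ : L} (hρ : extValue K L ρ = ((1 : ℝ) : WithTop ℝ)) {m : ℕ}
    {θ : 𝒪[K]} (h : ((m + 2 : ℕ) : EReal) ≤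
      vExt K L (π - (ρ + algebraMap K L (θ : K) * ρ ^ (m + 1)))) :
    ∃ u : L, π = ρ * (1 + u) ∧ ((m : ℝ) : WithTop ℝ) ≤ extValuation K L L u := by
  have hρ0 := ne_zero_of_extValue_eq_one hρ
  set v := extValuation K L L
  -- Precision m + 1 suffices, because θρ^(m+1) itself has valuation at least m + 1.
  have h1 : (((m + 1 : ℕ) : ℝ) : WithTop ℝ) ≤
      v (π - (ρ + algebraMap K L (θ : K) * ρ ^ (m + 1))) := by
    have h2 : (((m + 2 : ℕ) : ℝ) : WithTop ℝ) ≤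
      v (π - (ρ + algebraMap K L (θ : K) * ρ ^ (m + 1))) := coe_le_vExt_iff.mp h
    refine le_trans ?_ h2
    exact_mod_cast Nat.le_succ _
  have h3 : (((m + 1 : ℕ) : ℝ) : WithTop ℝ) ≤ v (algebraMap K L (θ : K) * ρ ^ (m + 1)) := by
    rw [AddValuation.map_mul, valuation_eq_of_extValue_eq_one hρ]
    exact le_add_of_nonneg_left (integerValuation_nonneg θ)
  have h4 : (((m + 1 : ℕ) : ℝ) : WithTop ℝ) ≤ v (π - ρ) := by
    have h5 := AddValuation.map_le_add v h1 h3
    rwa [sub_add_eq_sub_sub, sub_add_cancel] at h5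
  refine ⟨π / ρ - 1, by field_simp; ring, ?_⟩
  have h6 : π - ρ = (π / ρ - 1) * ρ := by field_simp
  have h7 : v ρ = ((1 : ℝ) : WithTop ℝ) := hρ
  rw [h6, AddValuation.map_mul, h7] at h4
  push_cast at h4
  exact (WithTop.add_le_add_iff_right (by exact WithTop.coe_ne_top)).mp h4

variable [Algebra.IsSeparable K L] (p : ℕ) [hp : Fact p.Prime] [CharP 𝓀[K] p]

lemma sub_mem_levelModule {f g : 𝒪[K][X]} {π ρ : L} (hf : f.Monic) (hg : g.Monic)
    (hfg : g.natDegree = f.natDegree) (hfE : f.IsEisensteinAt 𝓂[K]) (hgE : g.IsEisensteinAt 𝓂[K])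
    (hL : IntermediateField.adjoin K {π} = ⊤) (hπ : aeval π f = 0) (hρ : aeval ρ g = 0)
    {m : ℕ} {u : L} (hu : π = ρ * (1 + u)) (hmu : ((m : ℝ) : WithTop ℝ) ≤ extValuation K L L u) :
    f - g ∈ levelModule (integerValuation K L) p (padicValNat p f.natDegree)
      fun j => xi K L p j + f.natDegree + (p : ℝ) ^ j * m := by
  have hn := finrank_eq_natDegree hf hfE hπ hL
  have hvπ := extValue_root hf hfE hπ hn
  have hvρ := extValue_root hg hgE hρ (hn.trans hfg.symm)
  have hLρ := adjoin_eq_top_of_natDegree_eq hg hgE hρ (hn.trans hfg.symm)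
  obtain ⟨U, -, hUu, hU⟩ := exists_integer_expansion hvρ hLρ (Nat.cast_nonneg m) hmu
  have hμ := integerValuation_nonneg (K := K) (L := L)
  have hpe : integerValuation K L (p : 𝒪[K]) = extValue K L (p : L) := by
    rw [integerValuation_apply, map_natCast]
  have hUmem : U ∈ frobModule (integerValuation K L) p (m : ℝ) 0 := by
    rw [U.as_sum_range]
    refine Submodule.sum_mem _ fun l _ => Submodule.subset_span ⟨0, l, U.coeff l, le_rfl, by simp,
      ?_, by simp⟩
    have h1 := hU l
    rw [AddValuation.map_mul, valuation_eq_of_extValue_eq_one hvρ] at h1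
    rw [pow_zero, one_mul]
    exact h1
  have hH := comp_sub_mem_levelModule hμ (Nat.cast_nonneg m) hp.out (f := f) hUmem
    (s := padicValNat p f.natDegree) (M := fun j => xi K L p j + f.natDegree + (p : ℝ) ^ j * m)
    (fun i hi => by
      obtain ⟨a, has, hai, ha⟩ := xi_add_le_coeff p hf hfE hπ hL hi
      refine ⟨a, has, hai, fun b hb => ?_⟩
      rw [hpe, WithTop.coe_add]
      exact add_le_add_left (ha b hb) _)
  have hmod := modByMonic_mem_levelModule hμ (Nat.cast_nonneg m) hp.out (g := g)
    (s := padicValNat p f.natDegree) (ξ := xi K L p)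
    (fun j hj => xi_nonneg hL hvπ hp.out (by rwa [hn])) hg
    (fun i hi => by
      obtain ⟨a, has, hai, ha⟩ := xi_add_le_coeff p hg hgE hρ hLρ hi
      refine ⟨a, by rwa [← hfg], hai, ?_⟩
      have h1 := ha a le_rfl
      rwa [Nat.sub_self, zero_smul, add_zero] at h1)
    (fun i hi => natDegree_le_extValue_coeff hg hgE hρ hLρ hi)
    (by rw [hfg]; exact pow_padicValNat_dvd) (by rw [hfg]; exact hH)
  rw [hfg] at hmod
  set H := f.comp (X * (1 + U)) - f with hHdef
  -- Its value at ρ is f(π) - g(ρ) = 0, while its degree is less than that of the minimal polynomial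
  -- g of ρ.
  have hD : f - g + H %ₘ g = 0 := by
    have hval : aeval ρ (f - g + H %ₘ g) = 0 := by
      rw [map_add, aeval_modByMonic_eq_self_of_root hρ, hHdef, map_sub, map_sub, aeval_comp,
        map_mul, map_add, map_one, aeval_X, hUu, ← hu, hπ, hρ]
      ring
    have hdeg : (f - g + H %ₘ g).degree < g.degree := by
      refine (degree_add_le _ _).trans_lt (max_lt ?_ (degree_modByMonic_lt _ hg))
      have h1 : f.degree = g.degree := by
        rw [degree_eq_natDegree hf.ne_zero, degree_eq_natDegree hg.ne_zero, hfg]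
      rw [← h1]
      exact degree_sub_lt_left h1 hf.ne_zero (by rw [hf.leadingCoeff, hg.leadingCoeff])
    have hinj : Function.Injective (algebraMap 𝒪[K] K) := IsFractionRing.injective 𝒪[K] K
    by_contra hne
    have h2 := minpoly.degree_le_of_ne_zero K ρ (p := (f - g + H %ₘ g).map (algebraMap 𝒪[K] K))
      (by rwa [Ne, Polynomial.map_eq_zero_iff hinj]) (by rwa [aeval_map_algebraMap])
    rw [← map_eq_minpoly hg hgE hρ, degree_map_eq_of_injective hinj,
      degree_map_eq_of_injective hinj] at h2
    exact absurd hdeg (not_lt.mpr h2)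
  rw [eq_neg_of_add_eq_zero_left hD]
  exact neg_mem hmod

end Congruence

/-! ### Inclusion of Newton polygons. -/

section Polygons

variable {K : Type*} [Field K] [ValuativeRel K] [TopologicalSpace K] [IsNonarchimedeanLocalField K]
variable {L : Type*} [Field L] [Algebra K L]

section NewtonPolygon

variable {h : L[X]}

lemma convex_newtonPolygon : Convex ℝ (newtonPolygon K L h) := convex_convexHull ℝ _

/-- Translation by y - x ≥ 0 maps each generating quadrant into itself. -/
lemma mem_newtonPolygon_of_le {x y : ℝ × ℝ} (hx : x ∈ newtonPolygon K L h) (hxy : x ≤ y) :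
    y ∈ newtonPolygon K L h := by
  have h1 : newtonPolygon K L h ⊆ (fun z => (y - x) + z) ⁻¹' newtonPolygon K L h := by
    refine convexHull_min ?_ (convex_newtonPolygon.translate_preimage_right _)
    rintro z ⟨k, hk, hkz⟩
    refine subset_convexHull ℝ _ ⟨k, hk.trans ?_, hkz.trans ?_⟩
    · simpa using hxy.1
    · exact_mod_cast (by simpa using hxy.2 : z.2 ≤ ((y - x) + z).2)
  simpa using h1 hx

lemma mem_newtonPolygon_of_coeff {k : ℕ} {y : ℝ}
    (hk : extValue K L (h.coeff k) ≤ (y : WithTop ℝ)) : ((k : ℝ), y) ∈ newtonPolygon K L h :=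
  subset_convexHull ℝ _ ⟨k, le_rfl, vExt_le_coe_iff.mpr hk⟩

lemma mem_of_convex_of_mem_line {R : Set (ℝ × ℝ)} (hR : Convex ℝ R) {A B x y z : ℝ} (hxy : x ≤ y)
    (hyz : y ≤ z) (hx : (x, A + B * x) ∈ R) (hz : (z, A + B * z) ∈ R) : (y, A + B * y) ∈ R := by
  rcases hxy.eq_or_lt with rfl | hxy
  · exact hx
  have hxz : 0 < z - x := by linarith
  have h1 := hR hx hz (a := (z - y) / (z - x)) (b := (y - x) / (z - x))
    (div_nonneg (by linarith) hxz.le) (div_nonneg (by linarith) hxz.le) (by field_simp; ring)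
  convert! h1 using 1
  ext
  · simp; field_simp; ring
  · simp; field_simp; ring

end NewtonPolygon

section Polygon

variable [FiniteDimensional K L] [Algebra.IsSeparable K L] {f : 𝒪[K][X]} {π : L}
  (hf : f.Monic) (hE : f.IsEisensteinAt 𝓂[K]) (hfπ : aeval π f = 0)
  (hL : IntermediateField.adjoin K {π} = ⊤)

include hf hE hfπ hL

lemma extValue_coeff_countGT_le (x : ℝ) :
    extValue K L (((f.map (algebraMap 𝒪[K] L)).comp (C π + C π * X)).coeff
      (countGT (weight (K := K) π) x)) ≤
    ((truncSum (weight (K := K) π) x - countGT (weight (K := K) π) x * x + f.natDegree : ℝ) :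
      WithTop ℝ) := by
  rw [extValue_coeff_comp hf hE hfπ hL, finrank_eq_natDegree hf hE hfπ hL,
    add_comm (_ - _) (f.natDegree : ℝ), WithTop.coe_add]
  exact add_le_add_right (coeff_countGT_le (extValuation K L (SeparableClosure L)) _ x) _

lemma extValue_coeff_countGE_le (x : ℝ) :
    extValue K L (((f.map (algebraMap 𝒪[K] L)).comp (C π + C π * X)).coeff
      (countGE (weight (K := K) π) x)) ≤
    ((truncSum (weight (K := K) π) x - countGE (weight (K := K) π) x * x + f.natDegree : ℝ) :
      WithTop ℝ) := by
  rw [extValue_coeff_comp hf hE hfπ hL, finrank_eq_natDegree hf hE hfπ hL,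
    add_comm (_ - _) (f.natDegree : ℝ), WithTop.coe_add]
  exact add_le_add_right (coeff_countGE_le (extValuation K L (SeparableClosure L)) _ x) _

/-- At τ_j the abscissas `countGT` and `countGE` enclose p^j. The polygon contains points on the
line of slope m - τ_j at both of them, hence by convexity the point between. -/
lemma pow_xi_mem_newtonPolygon {p : ℕ} (hp : p.Prime) {j : ℕ} (hj : j ≤ padicValNat p f.natDegree)
    (m : ℕ) : (((p : ℝ) ^ j), xi K L p j + f.natDegree + (p : ℝ) ^ j * m) ∈
      newtonPolygon K L ((f.map (algebraMap 𝒪[K] L)).comp (C π + C (π ^ (m + 1)) * X)) := by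
  have hn := finrank_eq_natDegree hf hE hfπ hL
  have hπ := extValue_root hf hE hfπ hn
  have hπ0 := ne_zero_of_extValue_eq_one hπ
  rw [xi_eq_slopeIntercept hL hπ, slopeIntercept]
  set w := weight (K := K) π
  set τ := slopeBreak w ((p : ℝ) ^ j)
  have hmem {k : ℕ} (hk : extValue K L (((f.map (algebraMap 𝒪[K] L)).comp
      (C π + C π * X)).coeff k) ≤ ((truncSum w τ - k * τ + f.natDegree : ℝ) : WithTop ℝ)) :
      ((k : ℝ), truncSum w τ + f.natDegree + (m - τ) * k) ∈ newtonPolygon K L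
        ((f.map (algebraMap 𝒪[K] L)).comp (C π + C (π ^ (m + 1)) * X)) := by
    apply mem_newtonPolygon_of_coeff
    rw [coeff_comp_C_add_C_pow_mul_X, ← extValuation_apply, AddValuation.map_mul,
      valuation_eq_of_extValue_eq_one hπ]
    refine (add_le_add_left hk _).trans (le_of_eq ?_)
    rw [← WithTop.coe_add]
    congr 1
    push_cast
    ring
  have h1 := mem_of_convex_of_mem_line convex_newtonPolygon
    (countGT_slopeBreak_le (ncard_weight_eq_top_le_pow hL hπ0 hp j))
    (le_countGE_slopeBreak (weight_nonneg hπ0) (pow_le_card_algHom (by rwa [hn])))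
    (hmem (extValue_coeff_countGT_le hf hE hfπ hL τ))
    (hmem (extValue_coeff_countGE_le hf hE hfπ hL τ))
  convert! h1 using 2
  ring

variable (p : ℕ) [hp : Fact p.Prime] [CharP 𝓀[K] p]

/-- Some term f_i binom(i,k) π^i has at most the valuation of the whole k-th coefficient; replacing
binom(i,k) by binom(i,p^b) costs at most v_p(k) - b factors p. -/
lemma extValue_coeff_prime_pow_le {k b : ℕ} (hk : 0 < k)
    (hkt : extValue K L (((f.map (algebraMap 𝒪[K] L)).comp (C π + C π * X)).coeff k) ≠ ⊤)
    (hb : b ≤ padicValNat p k) :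
    extValue K L (((f.map (algebraMap 𝒪[K] L)).comp (C π + C π * X)).coeff (p ^ b)) ≤
      extValue K L (((f.map (algebraMap 𝒪[K] L)).comp (C π + C π * X)).coeff k) +
        (padicValNat p k - b) • extValue K L (p : L) := by
  have hn := finrank_eq_natDegree hf hE hfπ hL
  have hπ := extValue_root hf hE hfπ hn
  obtain ⟨i, hi, hle⟩ : ∃ i ≤ f.natDegree,
      extValue K L (algebraMap 𝒪[K] L (f.coeff i)) + extValue K L (i.choose k : L) +
        ((i : ℝ) : WithTop ℝ) ≤
      extValue K L (((f.map (algebraMap 𝒪[K] L)).comp (C π + C π * X)).coeff k) := by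
    by_contra! hlt
    refine lt_irrefl (extValue K L (((f.map (algebraMap 𝒪[K] L)).comp
      (C π + C π * X)).coeff k)) ?_
    conv_rhs => rw [coeff_comp_C_add_C_mul_X (f.map (algebraMap 𝒪[K] L)) π
      (N := f.natDegree + 1) (by rw [hf.natDegree_map]; omega) k]
    refine AddValuation.map_lt_sum (extValuation K L L) hkt fun i hi => ?_
    rw [AddValuation.map_mul, AddValuation.map_mul, valuation_eq_of_extValue_eq_one hπ, coeff_map]
    exact hlt i (Nat.lt_succ_iff.mp (Finset.mem_range.mp hi))
  have hki : k ≤ i := by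
    by_contra h
    rw [Nat.choose_eq_zero_of_lt (not_le.mp h)] at hle
    have h0 : extValue K L ((0 : ℕ) : L) = ⊤ := by simp [extValue]
    rw [h0, add_top, top_add, top_le_iff] at hle
    exact hkt hle
  have hbk : p ^ b ∣ k := (pow_dvd_pow p hb).trans pow_padicValNat_dvd
  have hbi : p ^ b ≤ i := (Nat.le_of_dvd hk hbk).trans hki
  refine (extValue_coeff_comp_le hf hE hfπ hL (pow_pos hp.out.pos _) (hk.trans_le hki) hi).trans ?_
  refine le_trans ?_ (add_le_add_left hle _)
  rw [add_right_comm _ _ ((i : ℝ) : WithTop ℝ), add_right_comm _ _ ((i : ℝ) : WithTop ℝ),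
    add_assoc (_ + _) (extValue K L (i.choose k : L))]
  refine add_le_add_right ?_ _
  rw [extValue_natCast p (Nat.choose_pos hbi).ne', extValue_natCast p (Nat.choose_pos hki).ne',
    ← add_smul]
  have h2 := padicValNat_choose_prime_pow_le (p := p) hk hki hbk
  exact nsmul_le_nsmul_left (extValue_natCast_nonneg p) (by omega)

/-- If τ_a > 0, the edge of slope -τ_a ends on the right at an abscissa p^c > p^a. Comparing heights
at p^a and p^c gives (p^c - p^a) τ_a ≤ (c - a)e. -/
lemma pow_sub_pow_mul_slopeBreak_le {e : ℝ} (he : extValue K L (p : L) = (e : WithTop ℝ)) (a : ℕ) :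
    ((p : ℝ) ^ (a + 1) - (p : ℝ) ^ a) * slopeBreak (weight (K := K) π) ((p : ℝ) ^ a) ≤ e := by
  have he0 : 0 ≤ e := by
    have := extValue_natCast_nonneg (K := K) (L := L) p
    rw [he] at this
    exact_mod_cast this
  set w := weight (K := K) π
  set τ := slopeBreak w ((p : ℝ) ^ a)
  rcases (slopeBreak_nonneg (w := w) ((p : ℝ) ^ a)).eq_or_lt with h0 | h0
  · rw [show τ = 0 from h0.symm, mul_zero]
    exact he0
  set V := fun k : ℕ =>
    extValue K L (((f.map (algebraMap 𝒪[K] L)).comp (C π + C π * X)).coeff k) with hV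
  set k := countGE w τ with hk
  have hak : p ^ a < k := by
    have h1 : (p : ℝ) ^ a < (k : ℝ) := lt_countGE_slopeBreak h0
    exact_mod_cast h1
  have hk0 : 0 < k := by omega
  have hVk : V k ≤ ((truncSum w τ - k * τ + f.natDegree : ℝ) : WithTop ℝ) :=
    extValue_coeff_countGE_le hf hE hfπ hL τ
  have hVt : V k ≠ ⊤ := ne_top_of_le_ne_top WithTop.coe_ne_top hVk
  have hlow (l : ℕ) : ((truncSum w τ - l * τ + f.natDegree : ℝ) : WithTop ℝ) ≤ V l :=
    le_extValue_coeff_comp hf hE hfπ hL τ l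
  -- The coefficient at the p-part of k is no higher than the one at k, but lies on or above a line
  -- of negative slope through a point at or above the latter; hence k is its own p-part.
  obtain ⟨c, hc⟩ : ∃ c, k = p ^ c := by
    refine ⟨padicValNat p k, le_antisymm ?_ (Nat.le_of_dvd hk0 pow_padicValNat_dvd)⟩
    have h1 := extValue_coeff_prime_pow_le hf hE hfπ hL p hk0 hVt le_rfl
    rw [Nat.sub_self, zero_smul, add_zero] at h1
    have h2 := (hlow _).trans (h1.trans hVk)
    rw [WithTop.coe_le_coe] at h2
    have h3 : (k : ℝ) * τ ≤ ((p ^ padicValNat p k : ℕ) : ℝ) * τ := by linarith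
    exact_mod_cast le_of_mul_le_mul_right h3 h0
  have hac : a < c := by
    rw [hc] at hak
    exact (Nat.pow_lt_pow_iff_right hp.out.one_lt).mp hak
  have hvk : padicValNat p k = c := by rw [hc, padicValNat.prime_pow]
  have h1 := extValue_coeff_prime_pow_le hf hE hfπ hL p hk0 hVt (hvk.symm ▸ hac.le)
  rw [hvk, he] at h1
  have h2 := (hlow _).trans (h1.trans (add_le_add_left hVk _))
  rw [← WithTop.coe_nsmul, ← WithTop.coe_add, WithTop.coe_le_coe, nsmul_eq_mul, hc] at h2
  obtain ⟨d, rfl⟩ := Nat.exists_eq_add_of_lt hac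
  rw [show a + d + 1 - a = d + 1 by omega] at h2
  push_cast at h2
  have hp1 : (1 : ℝ) ≤ p := by exact_mod_cast hp.out.one_lt.le
  -- Bernoulli gives p^c - p^a ≥ (c - a)(p^(a+1) - p^a), with c - a = d + 1.
  have hbern := one_add_mul_le_pow (a := (p : ℝ) - 1) (by linarith) (d + 1)
  rw [add_sub_cancel] at hbern
  push_cast at hbern
  have hpa : (0 : ℝ) < (p : ℝ) ^ a := by positivity
  have h3 : ((d : ℝ) + 1) * ((p : ℝ) ^ (a + 1) - (p : ℝ) ^ a) ≤
      (p : ℝ) ^ (a + d + 1) - (p : ℝ) ^ a := by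
    have h4 := mul_le_mul_of_nonneg_left hbern hpa.le
    have h5 : (p : ℝ) ^ (a + d + 1) = (p : ℝ) ^ a * (p : ℝ) ^ (d + 1) := by ring
    rw [h5, pow_succ]
    linarith
  have h6 := mul_le_mul_of_nonneg_right h3 h0.le
  have h7 : ((d : ℝ) + 1) * (((p : ℝ) ^ (a + 1) - (p : ℝ) ^ a) * τ) ≤ ((d : ℝ) + 1) * e := by
    rw [← mul_assoc]
    change ((d : ℝ) + 1) * ((p : ℝ) ^ (a + 1) - (p : ℝ) ^ a) * τ ≤
      ((p : ℝ) ^ (a + d + 1) - (p : ℝ) ^ a) * τ at h6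
    linarith
  exact le_of_mul_le_mul_left h7 (by positivity)

/-- Being a maximum, ξ_(j+1) is at least the value at τ_j, namely ξ_j - (p^(j+1) - p^j) τ_j ≥ ξ_j -
e. -/
lemma xi_le_add_mul {e : ℝ} (he : extValue K L (p : L) = (e : WithTop ℝ)) {a j : ℕ} (haj : a ≤ j)
    (hj : j ≤ padicValNat p f.natDegree) :
    xi K L p a ≤ xi K L p j + ((j - a : ℕ) : ℝ) * e := by
  have hn := finrank_eq_natDegree hf hE hfπ hL
  have hπ := extValue_root hf hE hfπ hn
  have hπ0 := ne_zero_of_extValue_eq_one hπ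
  induction j, haj using Nat.le_induction with
  | base => simp
  | succ j haj ih =>
    have h1 := ih (by omega)
    have h2 := pow_sub_pow_mul_slopeBreak_le hf hE hfπ hL p he j
    have h3 := truncSum_sub_le_slopeIntercept (weight_nonneg hπ0)
      (pow_le_card_algHom (by rwa [hn])) (ncard_weight_eq_top_le_pow hL hπ0 hp.out (j + 1))
      (slopeBreak (weight (K := K) π) ((p : ℝ) ^ j))
    have h4 : xi K L p j ≤ xi K L p (j + 1) + e := by
      rw [xi_eq_slopeIntercept hL hπ, xi_eq_slopeIntercept hL hπ]
      rw [slopeIntercept]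
      linarith
    rw [Nat.succ_sub haj]
    push_cast
    linarith

lemma coeff_comp_mem_newtonPolygon {m : ℕ} {h : 𝒪[K][X]}
    (hh : h ∈ levelModule (integerValuation K L) p (padicValNat p f.natDegree)
      fun j => xi K L p j + f.natDegree + (p : ℝ) ^ j * m) {k : ℕ} (hk : 0 < k) {y : ℝ}
    (hy : extValue K L (((h.map (algebraMap 𝒪[K] L)).comp (C π + C π * X)).coeff k) ≤
      (y : WithTop ℝ)) : ((k : ℝ), y) ∈
      newtonPolygon K L ((f.map (algebraMap 𝒪[K] L)).comp (C π + C (π ^ (m + 1)) * X)) := by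
  have hn := finrank_eq_natDegree hf hE hfπ hL
  have hπ := extValue_root hf hE hfπ hn
  induction hh using Submodule.span_induction with
  | zero => simp [extValue] at hy
  | add x₁ x₂ _ _ h₁ h₂ =>
    rw [Polynomial.map_add, add_comp, coeff_add] at hy
    -- A bound above the valuation of a sum is above that of a summand, so it suffices to treat
    -- monomials.
    rcases min_le_iff.mp ((AddValuation.map_add (extValuation K L L) _ _).trans hy) with h | h
    · exact h₁ h
    · exact h₂ h
  | smul r x _ h₁ =>
    refine h₁ (le_trans ?_ hy)
    rw [smul_eq_C_mul, Polynomial.map_mul, map_C, mul_comp, C_comp, coeff_C_mul,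
      ← extValuation_apply, ← extValuation_apply, AddValuation.map_mul]
    exact le_add_of_nonneg_left (integerValuation_nonneg r)
  | mem x hx =>
    obtain ⟨i, c, ⟨j, hjs, hji, hj⟩, rfl⟩ := hx
    have hcoeff : (((monomial i c).map (algebraMap 𝒪[K] L)).comp (C π + C π * X)).coeff k =
        algebraMap 𝒪[K] L c * (i.choose k : L) * π ^ i := by
      rw [map_monomial, coeff_comp_C_add_C_mul_X _ π
        (Nat.lt_succ_of_le (natDegree_monomial_le _)) k, Finset.sum_range_succ]
      rw [Finset.sum_eq_zero, coeff_monomial_same, zero_add]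
      intro l hl
      rw [coeff_monomial_of_ne _ (Finset.mem_range.mp hl).ne, zero_mul, zero_mul]
    rw [hcoeff, ← extValuation_apply, AddValuation.map_mul, AddValuation.map_mul,
      valuation_eq_of_extValue_eq_one hπ] at hy
    have hy' : ((xi K L p j + f.natDegree + (p : ℝ) ^ j * m : ℝ) : WithTop ℝ) +
        extValue K L (i.choose k : L) ≤ y := by
      refine le_trans (add_le_add_left hj _) (le_trans (le_of_eq ?_) hy)
      rw [add_right_comm]
      rfl
    have hki : k ≤ i := by
      by_contra h
      have h0 : extValue K L ((0 : ℕ) : L) = ⊤ := by simp [extValue]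
      rw [Nat.choose_eq_zero_of_lt (not_le.mp h), h0, add_top, top_le_iff] at hy'
      exact WithTop.coe_ne_top hy'
    by_cases hjk : p ^ j ∣ k
    · refine mem_newtonPolygon_of_le (pow_xi_mem_newtonPolygon hf hE hfπ hL hp.out hjs m) ⟨?_, ?_⟩
      · have h1 : ((p ^ j : ℕ) : ℝ) ≤ k := Nat.cast_le.mpr (Nat.le_of_dvd hk hjk)
        rwa [Nat.cast_pow] at h1
      · exact WithTop.coe_le_coe.mp
          ((le_add_of_nonneg_right (extValue_natCast_nonneg _)).trans hy')
    set a := padicValNat p k with ha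
    have haj : a < j := by
      by_contra h
      exact hjk ((pow_dvd_pow p (not_lt.mp h)).trans pow_padicValNat_dvd)
    have hji' : j ≤ padicValNat p i :=
      (padicValNat_dvd_iff_le (by omega)).mp hji
    have h1 := padicValNat_le_choose_add (p := p) hk hki
    rw [extValue_natCast p (Nat.choose_pos hki).ne'] at hy'
    have h2 : (j - a) • extValue K L (p : L) ≤
        padicValNat p (i.choose k) • extValue K L (p : L) :=
      nsmul_le_nsmul_left (extValue_natCast_nonneg p) (by omega)
    have h3 := (add_le_add_right h2 _).trans hy'
    -- As a < j, at least one factor p occurs in the binomial, so an infinite e would contradict the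
    -- finite bound y.
    have het : extValue K L (p : L) ≠ ⊤ := by
      intro h
      obtain ⟨d, hd⟩ := Nat.exists_eq_add_of_lt haj
      rw [h, show j - a = d + 1 by omega, succ_nsmul, add_top, add_top, top_le_iff] at h3
      exact WithTop.coe_ne_top h3
    obtain ⟨e, he⟩ := WithTop.ne_top_iff_exists.mp het
    rw [← he, ← WithTop.coe_nsmul, ← WithTop.coe_add, WithTop.coe_le_coe, nsmul_eq_mul] at h3
    have h4 := xi_le_add_mul hf hE hfπ hL p he.symm haj.le hjs
    refine mem_newtonPolygon_of_le
      (pow_xi_mem_newtonPolygon hf hE hfπ hL hp.out (haj.le.trans hjs) m) ⟨?_, ?_⟩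
    · have h5 : ((p ^ a : ℕ) : ℝ) ≤ k := Nat.cast_le.mpr (Nat.le_of_dvd hk pow_padicValNat_dvd)
      rwa [Nat.cast_pow] at h5
    · have h5 : (p : ℝ) ^ a * m ≤ (p : ℝ) ^ j * m :=
        mul_le_mul_of_nonneg_right
          (pow_le_pow_right₀ (by exact_mod_cast hp.out.one_lt.le) haj.le) (Nat.cast_nonneg m)
      change xi K L p a + f.natDegree + (p : ℝ) ^ a * m ≤ y
      linarith

end Polygon

end Polygons

end RamEisenstein

end

open RamEisenstein

theorem theorem2 {K : Type*} [Field K] [ValuativeRel K] [TopologicalSpace K]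
    [IsNonarchimedeanLocalField K] {L : Type*} [Field L] [Algebra K L] [Algebra.IsSeparable K L]
    (p : ℕ) [Fact p.Prime] [CharP 𝓀[K] p] (n m : ℕ) (f g : 𝒪[K][X])
    (hfm : f.Monic) (hgm : g.Monic) (hfn : f.natDegree = n) (hgn : g.natDegree = n)
    (hfE : f.IsEisensteinAt 𝓂[K]) (hgE : g.IsEisensteinAt 𝓂[K])
    (π ρ : L) (hL : IntermediateField.adjoin K {π} = ⊤)
    (hπ : aeval π f = 0) (hρ : aeval ρ g = 0) (θ : 𝒪[K])
    (hπρ : ((m + 2 : ℕ) : EReal) ≤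
      vExt K L (π - (ρ + algebraMap K L (θ : K) * ρ ^ (m + 1)))) :
    f - g ∈ (⨆ j ∈ Finset.range (padicValNat p n + 1),
        monomialModule K L (p ^ j) (xi K L p j + n + (p : ℝ) ^ j * m)) ∧
      newtonPolygon K L
          ((f.map (algebraMap 𝒪[K] L)).comp (C π + C π * X) - C (aeval π f)
            - (g.map (algebraMap 𝒪[K] L)).comp (C π + C π * X) + C (aeval π g)) ⊆
        newtonPolygon K L ((f.map (algebraMap 𝒪[K] L)).comp (C π + C (π ^ (m + 1)) * X)) := by
  subst hfn
  have hfin := finiteDimensional_of_adjoin_eq_top hfm hπ hL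
  have hn := finrank_eq_natDegree hfm hfE hπ hL
  obtain ⟨u, hu, hmu⟩ := exists_eq_mul_one_add
    (extValue_root hgm hgE hρ (hn.trans hgn.symm)) hπρ
  have hmem := sub_mem_levelModule p hfm hgm hgn hfE hgE hL hπ hρ hu hmu
  refine ⟨levelModule_le_iSup p _ _ hmem, convexHull_min ?_ convex_newtonPolygon⟩
  rintro ⟨x, y⟩ ⟨k, hkx, hky⟩
  rcases Nat.eq_zero_or_pos k with rfl | hk
  -- The constant coefficient is cancelled by the values at π, so it generates no quadrant.
  · exfalso
    have h0 (h : 𝒪[K][X]) : ((h.map (algebraMap 𝒪[K] L)).comp (C π + C π * X)).coeff 0 =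
        aeval π h := by
      rw [coeff_zero_eq_eval_zero, eval_comp, eval_map_algebraMap]
      simp
    rw [coeff_add, coeff_sub, coeff_sub, h0, h0, coeff_C_zero, coeff_C_zero, sub_self, zero_sub,
      neg_add_cancel, vExt, if_pos rfl, top_le_iff] at hky
    exact EReal.coe_ne_top _ hky
  · rw [vExt_le_coe_iff] at hky
    refine mem_newtonPolygon_of_le (x := ((k : ℝ), y))
      (coeff_comp_mem_newtonPolygon hfm hfE hπ hL p hmem hk ?_) ⟨hkx, le_rfl⟩
    rw [coeff_add, coeff_sub, coeff_sub, coeff_C_of_ne_zero hk.ne', coeff_C_of_ne_zero hk.ne',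
      sub_zero, add_zero] at hky
    rwa [Polynomial.map_sub, sub_comp, coeff_sub]
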